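/- Let $k\ge 1$, let $a_j,b_j,c_j\in\mathbb C$ $(1\le j\le k)$ with all $b_j\neq 0$ and $c_j\neq 0$, and let $L>0$. Let $T(f)$ be the tridiagonal $k$-Toeplitz operator on $\ell^2(\mathbb N,\mathbb C)$, i.e. the bounded operator given by the semi-infinite tridiagonal matrix whose diagonal, superdiagonal and subdiagonal are the $k$-periodic continuations of $(a_1,\dots,a_k)$, $(b_1,\dots,b_k)$ and $(c_1,\dots,c_k)$. Its symbol is $f(z)=A_{-1}z^{-1}+A_0+A_1z\in\mathbb C^{k\times k}$, where $A_0$ is the tridiagonal matrix with diagonal $(a_1,\dots,a_k)$, superdiagonal $(b_1,\dots,b_{k-1})$ and subdiagonal $(c_1,\dots,c_{k-1})$, the only nonzero entry of $A_{-1}$ is $b_k$ at position $(k,1)$, and the only nonzero entry of $A_1$ is $c_k$ at position $(1,k)$. Let $$\Delta=\ln\prod_{j=1}^k\left|\frac{b_j}{c_j}\right|,\qquad \zeta=\operatorname{Arg}\prod_{j=1}^k\frac{b_j}{c_j},$$ and let the generalised Brillouin zone be $$\mathcal B=\{\alpha+\mathrm i\beta:\ \alpha\in[-\pi/L,\pi/L),\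 \beta\in[0,\Delta/L]\}.$$ Here, if $\Delta<0$, every interval with endpoints $0$, $\Delta/(2L)$ or $\Delta/L$ is understood with its endpoints in increasing order (so $\beta\in[\Delta/L,0]$). **Theorem.** 1. $\displaystyle\bigcup_{\alpha+\mathrm i\beta\in\mathcal B}\sigma\big(f(e^{-\mathrm iL(\alpha+\mathrm i\beta)})\big)\subseteq\sigma(T(f))$, and at most $k-1$ points of $\sigma(T(f))$ do not belong to this union. 2. For every $\lambda\in\sigma(T(f))$ that belongs to the union, $\mathcal B$ contains exactly two corresponding quasiperiodicities, counted with multiplicity. Precisely, there are $$\kappa=\alpha+\mathrm i\beta\in[-\pi/L,\pi/L)+\mathrm i[0,\Delta/(2L)],\qquad \kappa'=\alpha'+\mathrm i\beta'\in[-\pi/L,\pi/L)+\mathrm i[\Delta/(2L),\Delta/L]$$ that are conjugate, meaning $\alpha'\equiv-\zeta/L-\alpha\pmod{2\pi/L}$ and $\beta'=\Delta/L-\beta$, such that $$\{w\in\mathcal B:\ \lambda\in\sigma(f(e^{-\mathrm iLw}))\}=\{\kappa,\kappa'\}\qquad\text{and}\qquad\sigma(f(e^{-\mathrm iL\kappa}))=\sigma(f(e^{-\mathrm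 iL\kappa'})).$$ If $\kappa\ne\kappa'$, then both are simple zeros of $w\mapsto\det(f(e^{-\mathrm iLw})-\lambda)$; if $\kappa=\kappa'$, it is a zero of order exactly two. -/

import Mathlib

noncomputable section

namespace KToeplitz

/-- The Hilbert space of square summable complex sequences indexed by the natural numbers. -/
abbrev EllTwo : Type := lp (fun _ : ℕ => ℂ) 2

/-- The `n`-th coordinate of the tridiagonal `k`-Toeplitz matrix applied to a sequence `x`.
The diagonal entry `(n, n)` is `a (n mod k)`, the superdiagonal entry `(n, n + 1)` is
`b (n mod k)` and the subdiagonal entry `(n + 1, n)` is `c (n mod k)`; all indices start at `0`. -/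
def rowAction {k : ℕ} [NeZero k] (a b c : Fin k → ℂ) (x : ℕ → ℂ) (n : ℕ) : ℂ :=
  (if n = 0 then 0 else c (Fin.ofNat k (n - 1)) * x (n - 1))
    + a (Fin.ofNat k n) * x n + b (Fin.ofNat k n) * x (n + 1)

theorem memℓp_mul {k : ℕ} [NeZero k] (d : Fin k → ℂ) {x : ℕ → ℂ}
    (hx : Memℓp (E := fun _ : ℕ => ℂ) x 2) :
    Memℓp (E := fun _ : ℕ => ℂ) (fun n => d (Fin.ofNat k n) * x n) 2 := by
  have h0 : (0 : ℝ) < (2 : ENNReal).toReal := by norm_num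
  rw [memℓp_gen_iff h0] at hx ⊢
  refine Summable.of_nonneg_of_le (fun n => by positivity) (fun n => ?_)
    (hx.mul_left ((∑ i, ‖d i‖) ^ (2 : ENNReal).toReal))
  rw [norm_mul, Real.mul_rpow (norm_nonneg _) (norm_nonneg _)]
  gcongr
  exact Finset.single_le_sum (f := fun i => ‖d i‖) (fun i _ => norm_nonneg _)
    (Finset.mem_univ (Fin.ofNat k n))

theorem memℓp_rowAction {k : ℕ} [NeZero k] (a b c : Fin k → ℂ) {x : ℕ → ℂ}
    (hx : Memℓp (E := fun _ : ℕ => ℂ) x 2) :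
    Memℓp (E := fun _ : ℕ => ℂ) (rowAction a b c x) 2 := by
  have h0 : (0 : ℝ) < (2 : ENNReal).toReal := by norm_num
  have hc : Memℓp (E := fun _ : ℕ => ℂ)
      (fun n => if n = 0 then 0 else c (Fin.ofNat k (n - 1)) * x (n - 1)) 2 := by
    have h := memℓp_mul c hx
    rw [memℓp_gen_iff h0] at h ⊢
    rw [← summable_nat_add_iff 1]
    simpa using h
  have hb : Memℓp (E := fun _ : ℕ => ℂ) (fun n => b (Fin.ofNat k n) * x (n + 1)) 2 := by
    refine memℓp_mul b (x := fun n => x (n + 1)) ?_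
    rw [memℓp_gen_iff h0] at hx ⊢
    exact (summable_nat_add_iff 1).2 hx
  exact (hc.add (memℓp_mul a hx)).add hb

/-- The tridiagonal `k`-Toeplitz operator with diagonal `a`, superdiagonal `b` and
subdiagonal `c`, as a linear map on square summable sequences. -/
def toeplitzLinear {k : ℕ} [NeZero k] (a b c : Fin k → ℂ) : EllTwo →ₗ[ℂ] EllTwo where
  toFun x := ⟨rowAction a b c x, memℓp_rowAction a b c x.2⟩
  map_add' x y := by
    ext n
    change rowAction a b c (⇑x + ⇑y) n = rowAction a b c x n + rowAction a b c y n
    by_cases h : n = 0 <;>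
      simp [rowAction, h] <;> ring
  map_smul' r x := by
    ext n
    change rowAction a b c (r • ⇑x) n = r • rowAction a b c x n
    by_cases h : n = 0 <;>
      simp [rowAction, h] <;> ring

theorem toeplitzLinear_continuous {k : ℕ} [NeZero k] (a b c : Fin k → ℂ) :
    Continuous (toeplitzLinear a b c) := by
  refine (toeplitzLinear a b c).continuous_of_seq_closed_graph fun u x y hu hTu => ?_
  have key : ∀ {v : ℕ → EllTwo} {w : EllTwo} (n : ℕ),
      Filter.Tendsto v Filter.atTop (nhds w) →
      Filter.Tendsto (fun i => v i n) Filter.atTop (nhds (w n)) := by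
    intro v w n hv
    exact ((lp.evalCLM ℂ (fun _ : ℕ => ℂ) 2 n).continuous.tendsto w).comp hv
  ext n
  refine tendsto_nhds_unique (key n hTu) ?_
  change Filter.Tendsto (fun i => rowAction a b c (u i) n) Filter.atTop
    (nhds (rowAction a b c x n))
  unfold rowAction
  refine Filter.Tendsto.add (Filter.Tendsto.add ?_ ((key n hu).const_mul _))
    ((key (n + 1) hu).const_mul _)
  by_cases h : n = 0
  · simp [h]
  · simpa [h] using (key (n - 1) hu).const_mul _

/-- The tridiagonal `k`-Toeplitz operator `T(f)` as a bounded operator on `ℓ²(ℕ)`. -/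
def toeplitz {k : ℕ} [NeZero k] (a b c : Fin k → ℂ) : EllTwo →L[ℂ] EllTwo :=
  ⟨toeplitzLinear a b c, toeplitzLinear_continuous a b c⟩

theorem toeplitz_apply {k : ℕ} [NeZero k] (a b c : Fin k → ℂ) (x : EllTwo) (n : ℕ) :
    toeplitz a b c x n = rowAction a b c x n := rfl

/-- The diagonal block `A₀` of the operator, seen as a block Toeplitz operator with blocks of
size `k`. -/
def blockZero {k : ℕ} (a b c : Fin k → ℂ) : Matrix (Fin k) (Fin k) ℂ :=
  Matrix.of fun i j =>
    if i = j then a i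
    else if (i : ℕ) + 1 = j then b i
    else if (j : ℕ) + 1 = i then c j
    else 0

/-- The block `A₋₁` above the diagonal: its only nonzero entry is the last entry of `b`, in the
lower left corner. -/
def blockUpper {k : ℕ} (b : Fin k → ℂ) : Matrix (Fin k) (Fin k) ℂ :=
  Matrix.of fun i j => if (i : ℕ) + 1 = k ∧ (j : ℕ) = 0 then b i else 0

/-- The block `A₁` below the diagonal: its only nonzero entry is the last entry of `c`, in the
upper right corner. -/
def blockLower {k : ℕ} (c : Fin k → ℂ) : Matrix (Fin k) (Fin k) ℂ :=
  Matrix.of fun i j => if (i : ℕ) = 0 ∧ (j : ℕ) + 1 = k then c j else 0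

/-- The symbol `f(z) = A₋₁ z⁻¹ + A₀ + A₁ z`, used for `z ≠ 0`. -/
def symbol {k : ℕ} (a b c : Fin k → ℂ) (z : ℂ) : Matrix (Fin k) (Fin k) ℂ :=
  z⁻¹ • blockUpper b + blockZero a b c + z • blockLower c

/-- The symbol at the quasiperiodicity `κ = α + iβ`, namely `f(e^{-iLκ})`. -/
def blochSymbol {k : ℕ} (a b c : Fin k → ℂ) (L : ℝ) (κ : ℂ) : Matrix (Fin k) (Fin k) ℂ :=
  symbol a b c (Complex.exp (-Complex.I * L * κ))

/-- The non-reciprocity rate `Δ`. -/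
def nonReciprocityRate {k : ℕ} (b c : Fin k → ℂ) : ℝ :=
  Real.log (∏ j, ‖b j / c j‖)

/-- The shift `ζ`. -/
def phaseShift {k : ℕ} (b c : Fin k → ℂ) : ℝ :=
  Complex.arg (∏ j, b j / c j)

/-- The generalised Brillouin zone: `α ∈ [-π/L, π/L)` and `β` between `0` and `Δ/L`, that is,
`β ∈ [0, Δ/L]` if `Δ ≥ 0` and `β ∈ [Δ/L, 0]` if `Δ < 0`. -/
def brillouinZone (L Δ : ℝ) : Set ℂ :=
  {κ | κ.re ∈ Set.Ico (-Real.pi / L) (Real.pi / L) ∧ κ.im ∈ Set.uIcc 0 (Δ / L)}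

/-- The union of the spectra of `f(e^{-iLκ})` over `κ` in the generalised Brillouin zone. -/
def blochSpectrum {k : ℕ} (a b c : Fin k → ℂ) (L : ℝ) : Set ℂ :=
  ⋃ κ ∈ brillouinZone L (nonReciprocityRate b c), spectrum ℂ (blochSymbol a b c L κ)

/-- The function `κ ↦ det (f(e^{-iLκ}) - μ)`, whose zeros are the quasiperiodicities
corresponding to `μ`. -/
def blochDet {k : ℕ} (a b c : Fin k → ℂ) (L : ℝ) (μ : ℂ) (κ : ℂ) : ℂ :=
  (blochSymbol a b c L κ - Matrix.scalar (Fin k) μ).det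

end KToeplitz

end

/-! Prepending a zero turns `(T(f) - z) x = y` into a three-term recurrence with `k`-periodic
coefficients and the boundary condition that entry 0 vanishes. Over one period, initial data are
transported by a 2×2 monodromy matrix built from the fundamental solutions `phi` and `psi`. Its
determinant is `∏ c / ∏ b`, and its eigenvalues `w₁, w₂` are the Floquet multipliers. A
quasiperiodic solution with multiplier `w` is an eigenvector of `f(w⁻¹)`, so `z ∈ σ(f(e^{-iLκ}))`
iff `e^{iLκ}` is a multiplier (`IsMultiplierPair.mem_spectrum_symbol_iff`).

Since `|e^{iLκ}| = e^{-Lβ}` and `|w₁ w₂| = e^{-Δ}`, the union over the Brillouin zone consists of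
the `z` whose multipliers are not strictly separated by the unit circle. If both lie inside the open
disc, `psi` is an eigenvector; if both lie outside the closed disc, the first basis vector is not in
the range. The limiting cases follow by rescaling `b ↦ r b`, `c ↦ r⁻¹ c`, which divides the
multipliers by `r ^ k`, and by openness of the invertible operators. If the circle separates the
multipliers, `T(f) - z` is invertible as soon as `psi` does not vanish at `k`; that value is a
polynomial in `z` of degree `k - 1`, whence the exceptional points.

For the second claim, `det (f(ζ) - z) = ±(∏ c · ζ + ∏ b · ζ⁻¹) + G`. The two roots `ζ` have product
`∏ b / ∏ c = e^{Δ + i arg}`, which gives conjugacy. Exchanging them swaps the two summands, which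
gives isospectrality, and the derivative in `κ` vanishes exactly when the summands agree, that is,
when the roots coincide. -/

noncomputable section

namespace KToeplitz

/-! ### Square summable sequences and scalar first order recurrences -/

/-- Square summability of a complex sequence. -/
def SqSummable (u : ℕ → ℂ) : Prop := Summable fun n => ‖u n‖ ^ 2

theorem sqSummable_iff_memℓp {u : ℕ → ℂ} :
    SqSummable u ↔ Memℓp (E := fun _ : ℕ => ℂ) u 2 := by
  have h0 : (0 : ℝ) < (2 : ENNReal).toReal := by norm_num
  rw [memℓp_gen_iff h0, SqSummable]
  simp

theorem SqSummable.add {u v : ℕ → ℂ} (hu : SqSummable u) (hv : SqSummable v) :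
    SqSummable fun n => u n + v n := by
  rw [sqSummable_iff_memℓp] at *
  exact hu.add hv

theorem SqSummable.const_mul {u : ℕ → ℂ} (hu : SqSummable u) (z : ℂ) :
    SqSummable fun n => z * u n := by
  rw [sqSummable_iff_memℓp] at *
  exact hu.const_smul z

theorem SqSummable.neg {u : ℕ → ℂ} (hu : SqSummable u) : SqSummable fun n => -u n := by
  simpa using hu.const_mul (-1)

theorem SqSummable.sub {u v : ℕ → ℂ} (hu : SqSummable u) (hv : SqSummable v) :
    SqSummable fun n => u n - v n := by
  simpa [sub_eq_add_neg] using hu.add hv.neg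

theorem sqSummable_zero : SqSummable fun _ => 0 := by
  simp [SqSummable, summable_zero]

theorem sqSummable_shift {u : ℕ → ℂ} (i : ℕ) :
    SqSummable (fun n => u (n + i)) ↔ SqSummable u :=
  summable_nat_add_iff (f := fun n => ‖u n‖ ^ 2) i

theorem SqSummable.tendsto_zero {u : ℕ → ℂ} (hu : SqSummable u) :
    Filter.Tendsto (fun n => ‖u n‖) Filter.atTop (nhds 0) := by
  have h := (Summable.tendsto_atTop_zero hu).sqrt
  simpa using h

theorem SqSummable.exists_bound {u : ℕ → ℂ} (hu : SqSummable u) : ∃ K, ∀ n, ‖u n‖ ≤ K := by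
  refine ⟨Real.sqrt (∑' n, ‖u n‖ ^ 2), fun n => Real.le_sqrt_of_sq_le ?_⟩
  exact Summable.le_tsum hu n fun j _ => by positivity

theorem SqSummable.comp_injective {u : ℕ → ℂ} (hu : SqSummable u) {f : ℕ → ℕ}
    (hf : Function.Injective f) : SqSummable fun n => u (f n) :=
  Summable.comp_injective hu hf

theorem SqSummable.block {u : ℕ → ℂ} (hu : SqSummable u) {k : ℕ} [NeZero k] (j : ℕ) :
    SqSummable fun m => u (m * k + j) :=
  hu.comp_injective fun m n h => by
    have := NeZero.ne k
    simpa [this] using h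

/-- A sequence is square summable if it is so along every residue class. -/
theorem sqSummable_of_blocks {u : ℕ → ℂ} {k : ℕ} [NeZero k]
    (h : ∀ j < k, SqSummable fun m => u (m * k + j)) : SqSummable u := by
  unfold SqSummable
  rw [← (Nat.divModEquiv k).symm.summable_iff, ← (Equiv.prodComm _ _).summable_iff,
    summable_prod_of_nonneg fun _ => by dsimp; positivity]
  refine ⟨fun j => ?_, Summable.of_finite⟩
  have h' := h j j.2
  simpa [SqSummable, Nat.divModEquiv, mul_comm, add_comm] using h'

/-- Convexity of the square, with weights `r` and `1 - r` at the points `x` and `y / (1 - r)`. -/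
theorem sq_mul_add_le {r x y : ℝ} (h0 : 0 ≤ r) (h1 : r < 1) :
    (r * x + y) ^ 2 ≤ r * x ^ 2 + y ^ 2 / (1 - r) := by
  have h : 0 < 1 - r := by linarith
  have key : r * x ^ 2 + y ^ 2 / (1 - r) - (r * x + y) ^ 2
      = r * ((1 - r) * x - y) ^ 2 / (1 - r) := by
    field_simp
    ring
  have : 0 ≤ r * ((1 - r) * x - y) ^ 2 / (1 - r) := by positivity
  linarith

/-- Forward solutions of a contracting first order recurrence are square summable. -/
theorem sqSummable_of_contracting {w : ℂ} (hw : ‖w‖ < 1) {u q : ℕ → ℂ}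
    (hu : ∀ m, u (m + 1) = w * u m + q m) (hq : SqSummable q) : SqSummable u := by
  have h1 : 0 < 1 - ‖w‖ := by linarith
  -- With `S` a partial sum of `‖u n‖ ^ 2` and `Q` the total for `q`, the recurrence gives `S ≤ ‖u
  -- 0‖ ^ 2 + ‖w‖ S + Q / (1 - ‖w‖)`; the constant is this solved for `S`.
  refine summable_of_sum_range_le (c := (‖u 0‖ ^ 2 + (∑' n, ‖q n‖ ^ 2) / (1 - ‖w‖)) / (1 - ‖w‖))
    (fun n => by positivity) fun N => ?_
  rw [le_div_iff₀ h1]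
  have hs : ∑ n ∈ Finset.range N, ‖u n‖ ^ 2
      ≤ ∑ n ∈ Finset.range N, ‖u (n + 1)‖ ^ 2 + ‖u 0‖ ^ 2 := by
    rw [← Finset.sum_range_succ' (fun n => ‖u n‖ ^ 2) N, Finset.sum_range_succ]
    linarith [sq_nonneg ‖u N‖]
  have hstep : ∑ n ∈ Finset.range N, ‖u (n + 1)‖ ^ 2
      ≤ ∑ n ∈ Finset.range N, (‖w‖ * ‖u n‖ ^ 2 + ‖q n‖ ^ 2 / (1 - ‖w‖)) := by
    refine Finset.sum_le_sum fun n _ => ?_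
    refine le_trans ?_ (sq_mul_add_le (norm_nonneg w) hw)
    rw [hu]
    gcongr
    exact (norm_add_le _ _).trans (by rw [norm_mul])
  rw [Finset.sum_add_distrib, ← Finset.mul_sum, ← Finset.sum_div] at hstep
  have hQ : (∑ n ∈ Finset.range N, ‖q n‖ ^ 2) / (1 - ‖w‖)
      ≤ (∑' n, ‖q n‖ ^ 2) / (1 - ‖w‖) := by
    gcongr
    exact Summable.sum_le_tsum _ (fun _ _ => by positivity) hq
  nlinarith

/-- An expanding first order recurrence has a square summable solution. -/
theorem exists_sqSummable_of_expanding {w : ℂ} (hw : 1 < ‖w‖) {q : ℕ → ℂ}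
    (hq : SqSummable q) : ∃ u : ℕ → ℂ, SqSummable u ∧ ∀ m, u (m + 1) = w * u m + q m := by
  have hw0 : w ≠ 0 := by
    rintro rfl
    norm_num at hw
  obtain ⟨K, hK⟩ := hq.exists_bound
  set r : ℝ := ‖w⁻¹‖ with hr
  have hr0 : 0 ≤ r := norm_nonneg _
  have hr1 : r < 1 := by
    rw [hr, norm_inv]
    exact inv_lt_one_of_one_lt₀ hw
  have h1 : 0 < 1 - r := by linarith
  have hbd : ∀ m j, ‖w⁻¹ ^ (j + 1) * q (m + j)‖ ≤ r ^ j * K := fun m j => by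
    rw [norm_mul, norm_pow, ← hr]
    have : r ^ (j + 1) ≤ r ^ j := pow_le_pow_of_le_one hr0 hr1.le (Nat.le_succ j)
    exact mul_le_mul this (hK _) (norm_nonneg _) (by positivity)
  have hgeo : Summable fun j : ℕ => r ^ j * K :=
    (summable_geometric_of_lt_one hr0 hr1).mul_right K
  have hsum : ∀ m, Summable fun j => w⁻¹ ^ (j + 1) * q (m + j) := fun m =>
    Summable.of_norm_bounded hgeo (hbd m)
  -- The recurrence solved backwards from infinity, by iterating `u m = w⁻¹ (u (m + 1) - q m)`.
  let u : ℕ → ℂ := fun m => -∑' j, w⁻¹ ^ (j + 1) * q (m + j)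
  have hrec' : ∀ m, u m = w⁻¹ * u (m + 1) - w⁻¹ * q m := fun m => by
    simp only [u]
    rw [(hsum m).tsum_eq_zero_add, mul_neg, ← tsum_mul_left]
    have : ∀ j, w⁻¹ ^ (j + 1 + 1) * q (m + (j + 1)) = w⁻¹ * (w⁻¹ ^ (j + 1) * q (m + 1 + j)) :=
      fun j => by rw [pow_succ w⁻¹ (j + 1), show m + (j + 1) = m + 1 + j by ring]; ring
    simp only [this]
    simp
    ring
  have hub : ∀ m, ‖u m‖ ≤ ∑' j : ℕ, r ^ j * K := fun m => by
    simp only [u, norm_neg]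
    exact tsum_of_norm_bounded hgeo.hasSum (hbd m)
  refine ⟨u, ?_, fun m => ?_⟩
  · set B := ∑' j : ℕ, r ^ j * K
    -- The series only shows that `u` is bounded by `B`. The backward recurrence then yields `S ≤ r
    -- (S + B ^ 2) + Q / (1 - r)` for the partial sums.
    refine summable_of_sum_range_le (c := (r * B ^ 2 + (∑' n, ‖q n‖ ^ 2) / (1 - r)) / (1 - r))
      (fun n => by positivity) fun N => ?_
    rw [le_div_iff₀ h1]
    have hs : ∑ n ∈ Finset.range N, ‖u (n + 1)‖ ^ 2
        ≤ ∑ n ∈ Finset.range N, ‖u n‖ ^ 2 + B ^ 2 := by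
      have h := Finset.sum_range_succ' (fun n => ‖u n‖ ^ 2) N
      rw [Finset.sum_range_succ] at h
      have hB : ‖u N‖ ^ 2 ≤ B ^ 2 := by
        gcongr
        exact hub N
      linarith [sq_nonneg ‖u 0‖]
    have hstep : ∑ n ∈ Finset.range N, ‖u n‖ ^ 2
        ≤ ∑ n ∈ Finset.range N, (r * ‖u (n + 1)‖ ^ 2 + ‖q n‖ ^ 2 / (1 - r)) := by
      refine Finset.sum_le_sum fun n _ => ?_
      refine le_trans ?_ (sq_mul_add_le hr0 hr1)
      rw [hrec' n]
      gcongr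
      refine (norm_sub_le _ _).trans ?_
      rw [norm_mul, norm_mul, ← hr]
      gcongr
      nlinarith [norm_nonneg (q n)]
    rw [Finset.sum_add_distrib, ← Finset.mul_sum, ← Finset.sum_div] at hstep
    have hQ : (∑ n ∈ Finset.range N, ‖q n‖ ^ 2) / (1 - r) ≤ (∑' n, ‖q n‖ ^ 2) / (1 - r) := by
      gcongr
      exact Summable.sum_le_tsum _ (fun _ _ => by positivity) hq
    nlinarith
  · rw [hrec' m]
    field_simp
    ring

theorem SqSummable.eq_zero_of_expanding {w : ℂ} (hw : 1 < ‖w‖) {u : ℕ → ℂ}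
    (hu : ∀ m, u (m + 1) = w * u m) (hs : SqSummable u) : u 0 = 0 := by
  have h : ∀ m, ‖u 0‖ ≤ ‖u m‖ := fun m => by
    induction m with
    | zero => rfl
    | succ m ih =>
      rw [hu, norm_mul]
      nlinarith [norm_nonneg (u m)]
  have := ge_of_tendsto' hs.tendsto_zero h
  exact norm_le_zero_iff.1 this

/-! ### Planar first order recurrences: stable and unstable directions -/

/-- The vector sequence `(x, y)` satisfies the two-dimensional first order recurrence with
matrix `!![p, q; r, s]` and inhomogeneity `(f, g)`. -/
structure PlanarRec (p q r s : ℂ) (f g x y : ℕ → ℂ) : Prop where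
  fst : ∀ m, x (m + 1) = p * x m + q * y m + f m
  snd : ∀ m, y (m + 1) = r * x m + s * y m + g m

namespace PlanarRec

variable {p q r s w₁ w₂ : ℂ} {f g x y : ℕ → ℂ}

/-- The row vector `(p - w₂, q)` satisfies the left eigenvector equation for `w₁`, so pairing with
it decouples the system to a scalar recurrence. -/
theorem fst_sub (h : PlanarRec p q r s f g x y) (htr : w₁ + w₂ = p + s)
    (hdet : w₁ * w₂ = p * s - q * r) (m : ℕ) :
    (p - w₂) * x (m + 1) + q * y (m + 1)
      = w₁ * ((p - w₂) * x m + q * y m) + ((p - w₂) * f m + q * g m) := by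
  rw [h.fst, h.snd]
  linear_combination (-p * x m - q * y m) * htr + x m * hdet

theorem swap (h : PlanarRec p q r s f g x y) : PlanarRec s r q p g f y x :=
  ⟨fun m => by rw [h.snd]; ring, fun m => by rw [h.fst]; ring⟩

/-- Triangularisation: `x (m + 1) = w₂ * x m + u m + f m`, where `u` is the decoupled quantity of
`fst_sub`. No diagonalisation is used, so `w₁ = w₂` is covered. -/
theorem fst_sqSummable (h : PlanarRec p q r s f g x y) (htr : w₁ + w₂ = p + s)
    (hdet : w₁ * w₂ = p * s - q * r) (h₁ : ‖w₁‖ < 1) (h₂ : ‖w₂‖ < 1)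
    (hf : SqSummable f) (hg : SqSummable g) : SqSummable x := by
  have hu := sqSummable_of_contracting (u := fun m => (p - w₂) * x m + q * y m) h₁ (h.fst_sub htr hdet)
    ((hf.const_mul (p - w₂)).add (hg.const_mul q))
  refine sqSummable_of_contracting h₂ (fun m => ?_) (hu.add hf)
  rw [h.fst]
  ring

theorem snd_sqSummable (h : PlanarRec p q r s f g x y) (htr : w₁ + w₂ = p + s)
    (hdet : w₁ * w₂ = p * s - q * r) (h₁ : ‖w₁‖ < 1) (h₂ : ‖w₂‖ < 1)
    (hf : SqSummable f) (hg : SqSummable g) : SqSummable y :=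
  h.swap.fst_sqSummable (by rw [htr]; ring) (by rw [hdet]; ring) h₁ h₂ hg hf

theorem shift (h : PlanarRec p q r s f g x y) (i : ℕ) :
    PlanarRec p q r s (fun m => f (m + i)) (fun m => g (m + i)) (fun m => x (m + i))
      (fun m => y (m + i)) :=
  ⟨fun m => by rw [← h.fst, add_right_comm], fun m => by rw [← h.snd, add_right_comm]⟩

theorem fst_sub_eq_zero (h : PlanarRec p q r s (fun _ => 0) (fun _ => 0) x y)
    (htr : w₁ + w₂ = p + s) (hdet : w₁ * w₂ = p * s - q * r) (h₁ : 1 < ‖w₁‖)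
    (hx : SqSummable x) (hy : SqSummable y) : (p - w₂) * x 0 + q * y 0 = 0 :=
  ((hx.const_mul (p - w₂)).add (hy.const_mul q)).eq_zero_of_expanding h₁
    fun m => by simpa using h.fst_sub htr hdet m

/-- The decoupled quantity vanishes at every time, by shifting; what remains is `x (m + 1) = w₂ * x
m`, which expands again. -/
theorem fst_eq_zero (h : PlanarRec p q r s (fun _ => 0) (fun _ => 0) x y)
    (htr : w₁ + w₂ = p + s) (hdet : w₁ * w₂ = p * s - q * r) (h₁ : 1 < ‖w₁‖) (h₂ : 1 < ‖w₂‖)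
    (hx : SqSummable x) (hy : SqSummable y) : x 0 = 0 := by
  refine hx.eq_zero_of_expanding h₂ fun m => ?_
  have hm := (h.shift m).fst_sub_eq_zero htr hdet h₁ ((sqSummable_shift m).2 hx)
    ((sqSummable_shift m).2 hy)
  rw [h.fst]
  simp only [zero_add] at hm
  linear_combination hm

theorem snd_eq_zero (h : PlanarRec p q r s (fun _ => 0) (fun _ => 0) x y)
    (htr : w₁ + w₂ = p + s) (hdet : w₁ * w₂ = p * s - q * r) (h₁ : 1 < ‖w₁‖) (h₂ : 1 < ‖w₂‖)
    (hx : SqSummable x) (hy : SqSummable y) : y 0 = 0 :=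
  h.swap.fst_eq_zero (by rw [htr]; ring) (by rw [hdet]; ring) h₁ h₂ hy hx

end PlanarRec

/-- In the hyperbolic case with `(0, 1)` transversal to the stable direction, the solution
starting at a suitable multiple of `(0, 1)` is square summable. -/
theorem exists_start_sqSummable {p q r s w₁ w₂ : ℂ} {f g : ℕ → ℂ}
    (htr : w₁ + w₂ = p + s) (hdet : w₁ * w₂ = p * s - q * r) (h₁ : ‖w₁‖ < 1) (h₂ : 1 < ‖w₂‖)
    (hq : q ≠ 0) (hf : SqSummable f) (hg : SqSummable g) :
    ∃ v : ℂ, ∀ x y : ℕ → ℂ, PlanarRec p q r s f g x y → x 0 = 0 → y 0 = v →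
      SqSummable x ∧ SqSummable y := by
  obtain ⟨P, hP, hPr⟩ := exists_sqSummable_of_expanding h₂ hf
  obtain ⟨Q, hQ, hQr⟩ := exists_sqSummable_of_expanding h₂ hg
  -- Square summability requires the unstable quantity `(p - w₁) x + q y` to be the decaying
  -- solution `(p - w₁) P + q Q`. Equating the two at time 0 with `x 0 = 0` determines `v`.
  refine ⟨Q 0 - P 0 * (w₁ - p) / q, fun x y h hx hy => ?_⟩
  have hu : ∀ m, (p - w₁) * x m + q * y m = (p - w₁) * P m + q * Q m := fun m => by
    induction m with
    | zero =>
      rw [hx, hy]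
      field_simp
      ring
    | succ m ih =>
      rw [h.fst_sub (w₁ := w₂) (w₂ := w₁) (by rw [← htr]; ring) (by rw [← hdet]; ring) m, ih,
        hPr, hQr]
      ring
  have hU := (hP.const_mul (p - w₁)).add (hQ.const_mul q)
  have hxs : SqSummable x := by
    refine sqSummable_of_contracting h₁ (fun m => ?_) (hU.add hf)
    rw [h.fst, ← hu]
    ring
  refine ⟨hxs, ?_⟩
  have hys := (hU.sub (hxs.const_mul (p - w₁))).const_mul q⁻¹
  convert hys using 2 with m
  rw [← hu]
  field_simp
  ring

/-! ### Three-term recurrences with periodic coefficients -/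

/-- The sequence `x` solves the three-term recurrence with coefficients `g, α, β` and right-hand
side `y`. -/
def IsSol (g α β y x : ℕ → ℂ) : Prop :=
  ∀ n, g n * x n + α n * x (n + 1) + β n * x (n + 2) = y n

/-- The solution of the three-term recurrence with initial values `u, v`. -/
def sol (g α β y : ℕ → ℂ) (u v : ℂ) : ℕ → ℂ
  | 0 => u
  | 1 => v
  | n + 2 => (y n - g n * sol g α β y u v n - α n * sol g α β y u v (n + 1)) / β n

/-- The homogeneous solution with initial values `1, 0`. -/
def solOne (g α β : ℕ → ℂ) : ℕ → ℂ := sol g α β (fun _ => 0) 1 0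

/-- The homogeneous solution with initial values `0, 1`. -/
def solTwo (g α β : ℕ → ℂ) : ℕ → ℂ := sol g α β (fun _ => 0) 0 1

section

variable {g α β y x : ℕ → ℂ} {k : ℕ}

@[simp] theorem sol_zero (u v : ℂ) : sol g α β y u v 0 = u := rfl

@[simp] theorem sol_one (u v : ℂ) : sol g α β y u v 1 = v := rfl

theorem sol_add_two (u v : ℂ) (n : ℕ) : sol g α β y u v (n + 2)
    = (y n - g n * sol g α β y u v n - α n * sol g α β y u v (n + 1)) / β n := rfl

theorem isSol_sol (hβ : ∀ n, β n ≠ 0) (u v : ℂ) : IsSol g α β y (sol g α β y u v) := fun n => by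
  rw [sol_add_two, mul_div_cancel₀ _ (hβ n)]
  ring

theorem sol_eq (u v : ℂ) (n : ℕ) : sol g α β y u v n
    = u * solOne g α β n + v * solTwo g α β n + sol g α β y 0 0 n := by
  suffices h : ∀ n, (sol g α β y u v n
      = u * solOne g α β n + v * solTwo g α β n + sol g α β y 0 0 n) ∧
      (sol g α β y u v (n + 1)
      = u * solOne g α β (n + 1) + v * solTwo g α β (n + 1) + sol g α β y 0 0 (n + 1)) from
    (h n).1
  intro n
  induction n with
  | zero => simp [solOne, solTwo]
  | succ n ih =>
    refine ⟨ih.2, ?_⟩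
    simp only [solOne, solTwo] at ih ⊢
    rw [sol_add_two, sol_add_two, sol_add_two, sol_add_two, ih.1, ih.2]
    ring

theorem sol_zero_zero (n : ℕ) : sol g α β (fun _ => 0) 0 0 n = 0 := by
  suffices h : ∀ n, sol g α β (fun _ => 0) 0 0 n = 0 ∧ sol g α β (fun _ => 0) 0 0 (n + 1) = 0 from
    (h n).1
  intro n
  induction n with
  | zero => simp
  | succ n ih => exact ⟨ih.2, by rw [sol_add_two, ih.1, ih.2]; simp⟩

theorem sol_homogeneous (u v : ℂ) (n : ℕ) : sol g α β (fun _ => 0) u v n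
    = u * solOne g α β n + v * solTwo g α β n := by
  rw [sol_eq, sol_zero_zero, add_zero]

theorem eq_sol_of_le {N : ℕ} (hβ : ∀ n, β n ≠ 0)
    (h : ∀ n < N, g n * x n + α n * x (n + 1) + β n * x (n + 2) = y n) {n : ℕ} (hn : n ≤ N + 1) :
    x n = sol g α β y (x 0) (x 1) n := by
  suffices h' : ∀ n ≤ N, x n = sol g α β y (x 0) (x 1) n ∧
      x (n + 1) = sol g α β y (x 0) (x 1) (n + 1) by
    cases n with
    | zero => rfl
    | succ n => exact (h' n (by omega)).2
  intro n
  induction n with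
  | zero => simp
  | succ n ih =>
    intro hn
    obtain ⟨h1, h2⟩ := ih (by omega)
    refine ⟨h2, ?_⟩
    rw [sol_add_two, ← h1, ← h2, eq_div_iff (hβ n), ← h n (by omega)]
    ring

theorem IsSol.eq_sol (hβ : ∀ n, β n ≠ 0) (h : IsSol g α β y x) (n : ℕ) :
    x n = sol g α β y (x 0) (x 1) n :=
  eq_sol_of_le (N := n) hβ (fun n _ => h n) (by omega)

/-- The left side is the Casoratian (discrete Wronskian), which each step multiplies by `g n / β n`.
At the end of a period it is the determinant of the monodromy matrix. -/
theorem solOne_mul_solTwo_sub (hβ : ∀ n, β n ≠ 0) (n : ℕ) :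
    solOne g α β n * solTwo g α β (n + 1) - solTwo g α β n * solOne g α β (n + 1)
      = ∏ i ∈ Finset.range n, g i / β i := by
  induction n with
  | zero => simp [solOne, solTwo]
  | succ n ih =>
    have := hβ n
    rw [Finset.prod_range_succ, ← ih]
    simp only [solOne, solTwo, sol_add_two]
    field_simp
    ring

theorem periodic_block {f : ℕ → ℂ} (hf : Function.Periodic f k) (m j : ℕ) :
    f (m * k + j) = f j := by
  rw [add_comm]
  exact hf.nat_mul m j

theorem IsSol.block (hβ : ∀ n, β n ≠ 0) (hgp : Function.Periodic g k)
    (hαp : Function.Periodic α k) (hβp : Function.Periodic β k) (h : IsSol g α β y x) (m : ℕ)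
    (j : ℕ) : x (m * k + j)
      = sol g α β (fun i => y (m * k + i)) (x (m * k)) (x (m * k + 1)) j := by
  refine IsSol.eq_sol (x := fun j => x (m * k + j)) hβ (fun n => ?_) j
  have := h (m * k + n)
  rwa [periodic_block hgp, periodic_block hαp, periodic_block hβp] at this

theorem sqSummable_sol {Y : ℕ → ℕ → ℂ} {u v : ℕ → ℂ} (hY : ∀ j, SqSummable fun m => Y m j)
    (hu : SqSummable u) (hv : SqSummable v) (j : ℕ) :
    SqSummable fun m => sol g α β (Y m) (u m) (v m) j := by
  suffices h : ∀ j, SqSummable (fun m => sol g α β (Y m) (u m) (v m) j) ∧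
      SqSummable (fun m => sol g α β (Y m) (u m) (v m) (j + 1)) from (h j).1
  intro j
  induction j with
  | zero => exact ⟨hu, hv⟩
  | succ j ih =>
    refine ⟨ih.2, ?_⟩
    have h := (((hY j).sub (ih.1.const_mul (g j))).sub (ih.2.const_mul (α j))).const_mul (β j)⁻¹
    convert h using 2 with m
    rw [sol_add_two, div_eq_inv_mul]

theorem IsSol.sqSummable [NeZero k] (hβ : ∀ n, β n ≠ 0) (hgp : Function.Periodic g k)
    (hαp : Function.Periodic α k) (hβp : Function.Periodic β k) (h : IsSol g α β y x)
    (hy : SqSummable y) (h₀ : SqSummable fun m => x (m * k))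
    (h₁ : SqSummable fun m => x (m * k + 1)) : SqSummable x := by
  refine sqSummable_of_blocks (k := k) fun j _ => ?_
  rw [funext fun m => h.block hβ hgp hαp hβp m j]
  exact sqSummable_sol (fun j => hy.block j) h₀ h₁ j

/-- The monodromy matrix has as columns the two fundamental solutions at `k` and `k + 1`; the
inhomogeneity is the response to `y` over one block from zero data. -/
theorem IsSol.planarRec (hβ : ∀ n, β n ≠ 0) (hgp : Function.Periodic g k)
    (hαp : Function.Periodic α k) (hβp : Function.Periodic β k) (h : IsSol g α β y x) :
    PlanarRec (solOne g α β k) (solTwo g α β k) (solOne g α β (k + 1)) (solTwo g α β (k + 1))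
      (fun m => sol g α β (fun i => y (m * k + i)) 0 0 k)
      (fun m => sol g α β (fun i => y (m * k + i)) 0 0 (k + 1))
      (fun m => x (m * k)) (fun m => x (m * k + 1)) := by
  constructor <;> intro m
  · rw [add_one_mul, h.block hβ hgp hαp hβp, sol_eq]
    ring
  · rw [add_one_mul, add_assoc, h.block hβ hgp hαp hβp, sol_eq]
    ring

variable [NeZero k] {w₁ w₂ : ℂ}

theorem sqSummable_solTwo (hβ : ∀ n, β n ≠ 0) (hgp : Function.Periodic g k)
    (hαp : Function.Periodic α k) (hβp : Function.Periodic β k)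
    (htr : w₁ + w₂ = solOne g α β k + solTwo g α β (k + 1))
    (hdet : w₁ * w₂ = solOne g α β k * solTwo g α β (k + 1)
      - solTwo g α β k * solOne g α β (k + 1))
    (h₁ : ‖w₁‖ < 1) (h₂ : ‖w₂‖ < 1) : SqSummable (solTwo g α β) := by
  have hs : IsSol g α β (fun _ => 0) (solTwo g α β) := isSol_sol hβ 0 1
  have hp := hs.planarRec hβ hgp hαp hβp
  have hz : ∀ j, SqSummable fun _ : ℕ => sol g α β (fun _ => 0) 0 0 j := fun j => by
    simpa only [sol_zero_zero] using sqSummable_zero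
  exact hs.sqSummable hβ hgp hαp hβp sqSummable_zero
    (hp.fst_sqSummable htr hdet h₁ h₂ (hz _) (hz _))
    (hp.snd_sqSummable htr hdet h₁ h₂ (hz _) (hz _))

/-- A sequence vanishing at two consecutive places and satisfying the homogeneous recurrence
below them vanishes there too. -/
theorem eq_zero_of_backward (hg : ∀ n, g n ≠ 0) {i N : ℕ} (hi : i ≤ N)
    (h : ∀ n, i ≤ n → g n * x n + α n * x (n + 1) + β n * x (n + 2) = 0)
    (h₀ : x N = 0) (h₁ : x (N + 1) = 0) : x i = 0 ∧ x (i + 1) = 0 := by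
  induction N with
  | zero =>
    obtain rfl : i = 0 := by omega
    exact ⟨h₀, h₁⟩
  | succ N ih =>
    rcases hi.eq_or_lt with rfl | hlt
    · exact ⟨h₀, h₁⟩
    · refine ih (by omega) ?_ h₀
      have := h N (by omega)
      rw [h₀, h₁] at this
      simpa [hg N] using this

/-- From the second block on the recurrence is homogeneous and expanding, so `x` vanishes at `k` and
`k + 1`. Running it backwards gives `x 1 = x 2 = 0`, and row 0 then forces `y 0 = 0`. -/
theorem not_isSol_of_expanding (hg : ∀ n, g n ≠ 0) (hβ : ∀ n, β n ≠ 0)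
    (hgp : Function.Periodic g k)
    (hαp : Function.Periodic α k) (hβp : Function.Periodic β k)
    (htr : w₁ + w₂ = solOne g α β k + solTwo g α β (k + 1))
    (hdet : w₁ * w₂ = solOne g α β k * solTwo g α β (k + 1)
      - solTwo g α β k * solOne g α β (k + 1))
    (h₁ : 1 < ‖w₁‖) (h₂ : 1 < ‖w₂‖) (hx : SqSummable x) (hx0 : x 0 = 0)
    (hy0 : y 0 ≠ 0) (hy : ∀ n, n ≠ 0 → y n = 0) : ¬ IsSol g α β y x := by
  intro hs
  have hk : 0 < k := Nat.pos_of_neZero k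
  have hz : ∀ m j, sol g α β (fun i => y ((m + 1) * k + i)) 0 0 j = 0 := by
    intro m j
    have : (fun i => y ((m + 1) * k + i)) = fun _ => 0 :=
      funext fun i => hy _ (by positivity)
    rw [this, sol_zero_zero]
  have hp := (hs.planarRec hβ hgp hαp hβp).shift 1
  simp only [hz] at hp
  have hx1 : SqSummable fun m => x ((m + 1) * k) :=
    (sqSummable_shift (u := fun m => x (m * k)) 1).2 (hx.block 0)
  have hx2 : SqSummable fun m => x ((m + 1) * k + 1) :=
    (sqSummable_shift (u := fun m => x (m * k + 1)) 1).2 (hx.block 1)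
  have e1 := hp.fst_eq_zero htr hdet h₁ h₂ hx1 hx2
  have e2 := hp.snd_eq_zero htr hdet h₁ h₂ hx1 hx2
  simp only [zero_add, one_mul] at e1 e2
  have e := eq_zero_of_backward (i := 1) hg hk (fun n hn => by
    rw [hs n, hy n (by omega)]) e1 e2
  have := hs 0
  exact hy0 (by simpa [hx0, e.1, e.2] using this.symm)

/-- The condition at `k` says that `(0, 1)`, the direction of data with `x 0 = 0`, is not an
eigenvector of the monodromy matrix, hence transversal to the stable direction. One value of `x 1`
then cancels the growing part. -/
theorem exists_isSol_of_hyperbolic (hβ : ∀ n, β n ≠ 0) (hgp : Function.Periodic g k)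
    (hαp : Function.Periodic α k) (hβp : Function.Periodic β k)
    (htr : w₁ + w₂ = solOne g α β k + solTwo g α β (k + 1))
    (hdet : w₁ * w₂ = solOne g α β k * solTwo g α β (k + 1)
      - solTwo g α β k * solOne g α β (k + 1))
    (h₁ : ‖w₁‖ < 1) (h₂ : 1 < ‖w₂‖) (hne : solTwo g α β k ≠ 0) (hy : SqSummable y) :
    ∃ x, IsSol g α β y x ∧ x 0 = 0 ∧ SqSummable x := by
  have hR : ∀ j, SqSummable fun m => sol g α β (fun i => y (m * k + i)) 0 0 j :=
    sqSummable_sol (fun j => hy.block j) sqSummable_zero sqSummable_zero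
  obtain ⟨v, hv⟩ := exists_start_sqSummable htr hdet h₁ h₂ hne (hR k) (hR (k + 1))
  have hs : IsSol g α β y (sol g α β y 0 v) := isSol_sol hβ 0 v
  obtain ⟨h1, h2⟩ := hv _ _ (hs.planarRec hβ hgp hαp hβp) (by simp) (by simp)
  exact ⟨_, hs, rfl, hs.sqSummable hβ hgp hαp hβp hy h1 h2⟩

theorem eq_zero_of_hyperbolic (hβ : ∀ n, β n ≠ 0) (hgp : Function.Periodic g k)
    (hαp : Function.Periodic α k) (hβp : Function.Periodic β k)
    (htr : w₁ + w₂ = solOne g α β k + solTwo g α β (k + 1))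
    (hdet : w₁ * w₂ = solOne g α β k * solTwo g α β (k + 1)
      - solTwo g α β k * solOne g α β (k + 1))
    (h₂ : 1 < ‖w₂‖) (hne : solTwo g α β k ≠ 0) (hx : SqSummable x) (hx0 : x 0 = 0)
    (hs : IsSol g α β (fun _ => 0) x) : x = fun _ => 0 := by
  have hp := hs.planarRec hβ hgp hαp hβp
  simp only [sol_zero_zero] at hp
  have h := hp.fst_sub_eq_zero (w₁ := w₂) (w₂ := w₁) (by rw [← htr]; ring) (by rw [← hdet]; ring)
    h₂ (hx.block 0) (hx.block 1)
  have hx1 : x 1 = 0 := by simpa [hx0, hne] using h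
  funext n
  rw [hs.eq_sol hβ, hx0, hx1, sol_zero_zero]

end

/-! ### Spectrum of the Toeplitz operator from the Floquet multipliers -/

variable {k : ℕ} [NeZero k]

/-- The `k`-periodic extension of a vector. -/
def perSeq (d : Fin k → ℂ) (n : ℕ) : ℂ := d (Fin.ofNat k n)

/-- The `k`-periodic extension of a vector, shifted by one place. -/
def perSeqPred (d : Fin k → ℂ) (n : ℕ) : ℂ := d (Fin.ofNat k (n + (k - 1)))

/-- The sequence `0, x 0, x 1, …`. -/
def pad (x : ℕ → ℂ) : ℕ → ℂ
  | 0 => 0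
  | n + 1 => x n

@[simp] theorem pad_zero (x : ℕ → ℂ) : pad x 0 = 0 := rfl

@[simp] theorem pad_succ (x : ℕ → ℂ) (n : ℕ) : pad x (n + 1) = x n := rfl

theorem pad_tail {x : ℕ → ℂ} (hx : x 0 = 0) : pad (fun n => x (n + 1)) = x := by
  funext n
  cases n with
  | zero => exact hx.symm
  | succ n => rfl

theorem sqSummable_pad {x : ℕ → ℂ} : SqSummable (pad x) ↔ SqSummable x :=
  (sqSummable_shift (u := pad x) 1).symm


theorem perSeq_periodic (d : Fin k → ℂ) : Function.Periodic (perSeq d) k := fun n => by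
  simp [perSeq, Fin.ofNat]

theorem perSeqPred_periodic (d : Fin k → ℂ) : Function.Periodic (perSeqPred d) k := fun n => by
  simp only [perSeqPred, Fin.ofNat, add_right_comm n k, Nat.add_mod_right]

theorem perSeqPred_succ (d : Fin k → ℂ) (n : ℕ) : perSeqPred d (n + 1) = perSeq d n := by
  have : n + 1 + (k - 1) = n + k := by have := Nat.pos_of_neZero k; omega
  simp only [perSeqPred, perSeq, Fin.ofNat, this, Nat.add_mod_right]

theorem perSeqPred_zero (d : Fin k → ℂ) : perSeqPred d 0 = perSeq d (k - 1) := by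
  simp [perSeqPred, perSeq]

theorem perSeq_val (d : Fin k → ℂ) (j : Fin k) : perSeq d j = d j := by
  simp [perSeq]

theorem prod_perSeq (d : Fin k → ℂ) : ∏ i ∈ Finset.range k, perSeq d i = ∏ j, d j := by
  rw [← Fin.prod_univ_eq_prod_range]
  simp only [perSeq_val]

theorem prod_perSeqPred (d : Fin k → ℂ) : ∏ i ∈ Finset.range k, perSeqPred d i = ∏ j, d j := by
  rw [← prod_perSeq]
  have hk : Finset.range k = Finset.range (k - 1 + 1) := by
    rw [Nat.sub_add_cancel (Nat.pos_of_neZero k)]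
  rw [hk, Finset.prod_range_succ', Finset.prod_range_succ, perSeqPred_zero]
  simp only [perSeqPred_succ]

/-- The bulk homogeneous solution `1, 0, …` at spectral parameter `z`. -/
def phi (a b c : Fin k → ℂ) (z : ℂ) : ℕ → ℂ :=
  solOne (perSeqPred c) (fun n => perSeq a n - z) (perSeq b)

/-- The homogeneous solution `0, 1, …` at spectral parameter `z`. -/
def psi (a b c : Fin k → ℂ) (z : ℂ) : ℕ → ℂ :=
  solTwo (perSeqPred c) (fun n => perSeq a n - z) (perSeq b)

/-- The numbers `w₁, w₂` are the Floquet multipliers of the recurrence at the spectral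
parameter `z`. -/
structure IsMultiplierPair (a b c : Fin k → ℂ) (z w₁ w₂ : ℂ) : Prop where
  add : w₁ + w₂ = phi a b c z k + psi a b c z (k + 1)
  mul : w₁ * w₂ = (∏ j, c j) / ∏ j, b j

/-- `x` solves the recurrence of the tridiagonal `k`-Toeplitz matrix minus `z`. -/
abbrev IsBulkSol (a b c : Fin k → ℂ) (z : ℂ) (y x : ℕ → ℂ) : Prop :=
  IsSol (perSeqPred c) (fun n => perSeq a n - z) (perSeq b) y x

/-- Padding makes row 0 like every other row: the coefficient in front of the missing entry is
multiplied by `pad x 0 = 0`. -/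
theorem rowAction_sub (a b c : Fin k → ℂ) (z : ℂ) (x : ℕ → ℂ) (n : ℕ) :
    rowAction a b c x n - z * x n = perSeqPred c n * pad x n
      + (perSeq a n - z) * pad x (n + 1) + perSeq b n * pad x (n + 2) := by
  cases n with
  | zero => simp [rowAction, perSeq]; ring
  | succ n => simp [rowAction, perSeqPred_succ, perSeq]; ring

theorem toeplitz_sub_apply (a b c : Fin k → ℂ) (z : ℂ) (x : EllTwo) (n : ℕ) :
    (toeplitz a b c - algebraMap ℂ (EllTwo →L[ℂ] EllTwo) z) x n = rowAction a b c x n - z * x n := by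
  rw [sub_apply, lp.coeFn_sub, Pi.sub_apply, toeplitz_apply,
    Algebra.algebraMap_eq_smul_one]
  rfl

theorem isBulkSol_pad_iff (a b c : Fin k → ℂ) (z : ℂ) (x y : EllTwo) :
    IsBulkSol a b c z y (pad x) ↔ (toeplitz a b c - algebraMap ℂ (EllTwo →L[ℂ] EllTwo) z) x = y := by
  rw [lp.ext_iff, funext_iff]
  refine forall_congr' fun n => ?_
  rw [toeplitz_sub_apply, rowAction_sub]

theorem mem_spectrum_toeplitz_iff (a b c : Fin k → ℂ) (z : ℂ) :
    z ∈ spectrum ℂ (toeplitz a b c) ↔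
      ¬ Function.Bijective (toeplitz a b c - algebraMap ℂ (EllTwo →L[ℂ] EllTwo) z) := by
  rw [spectrum.mem_iff, ← IsUnit.neg_iff, neg_sub,
    ContinuousLinearMap.isUnit_iff_bijective]

theorem coe_sqSummable (x : EllTwo) : SqSummable x := sqSummable_iff_memℓp.2 x.2

theorem perSeq_ne_zero {d : Fin k → ℂ} (hd : ∀ j, d j ≠ 0) (n : ℕ) : perSeq d n ≠ 0 := hd _

theorem perSeqPred_ne_zero {d : Fin k → ℂ} (hd : ∀ j, d j ≠ 0) (n : ℕ) : perSeqPred d n ≠ 0 :=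
  hd _

theorem perSeq_sub_periodic (a : Fin k → ℂ) (z : ℂ) :
    Function.Periodic (fun n => perSeq a n - z) k := fun n => by
  simp only [perSeq_periodic a n]

theorem phi_mul_psi_sub {a b c : Fin k → ℂ} (hb : ∀ j, b j ≠ 0) (z : ℂ) :
    phi a b c z k * psi a b c z (k + 1) - psi a b c z k * phi a b c z (k + 1)
      = (∏ j, c j) / ∏ j, b j := by
  rw [phi, psi, solOne_mul_solTwo_sub (perSeq_ne_zero hb), Finset.prod_div_distrib,
    prod_perSeq, prod_perSeqPred]

variable {a b c : Fin k → ℂ} {z w₁ w₂ : ℂ}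

theorem IsMultiplierPair.mul_eq (hb : ∀ j, b j ≠ 0) (h : IsMultiplierPair a b c z w₁ w₂) :
    w₁ * w₂ = phi a b c z k * psi a b c z (k + 1) - psi a b c z k * phi a b c z (k + 1) := by
  rw [h.mul, phi_mul_psi_sub hb]

theorem IsMultiplierPair.mem_spectrum_of_lt_one (hb : ∀ j, b j ≠ 0)
    (h : IsMultiplierPair a b c z w₁ w₂) (h₁ : ‖w₁‖ < 1) (h₂ : ‖w₂‖ < 1) :
    z ∈ spectrum ℂ (toeplitz a b c) := by
  rw [mem_spectrum_toeplitz_iff]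
  intro hbij
  have hs : SqSummable (psi a b c z) := sqSummable_solTwo (perSeq_ne_zero hb)
    (perSeqPred_periodic c) (perSeq_sub_periodic a z) (perSeq_periodic b) h.add (h.mul_eq hb) h₁ h₂
  let x : EllTwo := ⟨fun n => psi a b c z (n + 1),
    sqSummable_iff_memℓp.1 ((sqSummable_shift 1).2 hs)⟩
  have hx : (toeplitz a b c - algebraMap ℂ (EllTwo →L[ℂ] EllTwo) z) x = 0 := by
    rw [← isBulkSol_pad_iff]
    change IsBulkSol a b c z (fun _ => 0) (pad fun n => psi a b c z (n + 1))
    rw [pad_tail rfl]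
    exact isSol_sol (perSeq_ne_zero hb) 0 1
  have hx0 : x = 0 := hbij.1 (by rw [hx, map_zero])
  have : x 0 = (0 : EllTwo) 0 := by rw [hx0]
  exact one_ne_zero this

/-- Surjectivity fails: the first basis vector has no square summable preimage. -/
theorem IsMultiplierPair.mem_spectrum_of_one_lt (hb : ∀ j, b j ≠ 0) (hc : ∀ j, c j ≠ 0)
    (h : IsMultiplierPair a b c z w₁ w₂) (h₁ : 1 < ‖w₁‖) (h₂ : 1 < ‖w₂‖) :
    z ∈ spectrum ℂ (toeplitz a b c) := by
  rw [mem_spectrum_toeplitz_iff]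
  intro hbij
  obtain ⟨x, hx⟩ := hbij.2 (lp.single 2 0 1)
  rw [← isBulkSol_pad_iff] at hx
  refine not_isSol_of_expanding (perSeqPred_ne_zero hc) (perSeq_ne_zero hb)
    (perSeqPred_periodic c) (perSeq_sub_periodic a z) (perSeq_periodic b) h.add (h.mul_eq hb) h₁ h₂
    (sqSummable_pad.2 (coe_sqSummable x)) rfl ?_ ?_ hx
  · simp
  · intro n hn
    simp [hn]

theorem IsMultiplierPair.notMem_spectrum (hb : ∀ j, b j ≠ 0)
    (h : IsMultiplierPair a b c z w₁ w₂) (h₁ : ‖w₁‖ < 1) (h₂ : 1 < ‖w₂‖)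
    (hne : psi a b c z k ≠ 0) : z ∉ spectrum ℂ (toeplitz a b c) := by
  rw [mem_spectrum_toeplitz_iff, not_not]
  constructor
  · rw [injective_iff_map_eq_zero]
    intro x hx
    rw [← isBulkSol_pad_iff] at hx
    have := eq_zero_of_hyperbolic (perSeq_ne_zero hb) (perSeqPred_periodic c)
      (perSeq_sub_periodic a z) (perSeq_periodic b) h.add (h.mul_eq hb) h₂ hne
      (sqSummable_pad.2 (coe_sqSummable x)) rfl hx
    ext n
    exact congrFun this (n + 1)
  · intro y
    obtain ⟨x, hx, hx0, hxs⟩ := exists_isSol_of_hyperbolic (perSeq_ne_zero hb)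
      (perSeqPred_periodic c) (perSeq_sub_periodic a z) (perSeq_periodic b) h.add (h.mul_eq hb)
      h₁ h₂ hne (coe_sqSummable y)
    refine ⟨⟨fun n => x (n + 1), sqSummable_iff_memℓp.1 ((sqSummable_shift 1).2 hxs)⟩, ?_⟩
    rw [← isBulkSol_pad_iff]
    change IsBulkSol a b c z y (pad fun n => x (n + 1))
    rwa [pad_tail hx0]

-- The operator depends continuously on `r` near 1 and the units are open. This carries the strict
-- multiplier criteria over to multipliers on the unit circle.
open Filter Topology in
theorem mem_spectrum_toeplitz_of_frequently {k : ℕ} [NeZero k] {a b c : Fin k → ℂ} {z : ℂ}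
    (h : ∃ᶠ r : ℝ in 𝓝 1, z ∈ spectrum ℂ (toeplitz a ((r : ℂ) • b) ((r : ℂ)⁻¹ • c))) :
    z ∈ spectrum ℂ (toeplitz a b c) := by
  by_contra hz
  let F : ℝ → (EllTwo →L[ℂ] EllTwo) := fun r => toeplitz a ((r : ℂ) • b) ((r : ℂ)⁻¹ • c)
  have hF : ∀ r, F r
      = toeplitz a 0 0 + (r : ℂ) • toeplitz 0 b 0 + (r : ℂ)⁻¹ • toeplitz 0 0 c := fun r => by
    ext x n
    change rowAction _ _ _ x n = rowAction _ _ _ x n + (r : ℂ) * rowAction _ _ _ x n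
      + (r : ℂ)⁻¹ * rowAction _ _ _ x n
    by_cases hn : n = 0 <;> simp [rowAction, hn] <;> ring
  have hcont : ContinuousAt (fun r => algebraMap ℂ (EllTwo →L[ℂ] EllTwo) z - F r) 1 := by
    simp_rw [hF]
    have h1 : ContinuousAt (fun r : ℝ => (r : ℂ)) 1 := Complex.continuous_ofReal.continuousAt
    have h2 : ContinuousAt (fun r : ℝ => (r : ℂ)⁻¹) 1 := h1.inv₀ (by simp)
    exact continuousAt_const.sub
      ((continuousAt_const.add (h1.smul continuousAt_const)).add (h2.smul continuousAt_const))
  have hF1 : F 1 = toeplitz a b c := by simp [F]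
  have hunit : IsUnit (algebraMap ℂ (EllTwo →L[ℂ] EllTwo) z - F 1) := by
    rw [hF1]
    exact spectrum.notMem_iff.1 hz
  have hev := hcont.eventually (Units.isOpen.mem_nhds hunit)
  obtain ⟨r, hr, hr'⟩ := (h.and_eventually hev).exists
  exact hr hr'

/-- The gauge transformation `x n ↦ r ^ n * x n` absorbs the rescaling of the off-diagonals. -/
theorem sol_scale {g α β : ℕ → ℂ} {r : ℂ} (hr : r ≠ 0) (u v : ℂ) (n : ℕ) :
    sol (fun n => r⁻¹ * g n) α (fun n => r * β n) (fun _ => 0) u v n * r ^ n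
      = sol g α β (fun _ => 0) u (r * v) n := by
  suffices h : ∀ n, sol (fun n => r⁻¹ * g n) α (fun n => r * β n) (fun _ => 0) u v n * r ^ n
      = sol g α β (fun _ => 0) u (r * v) n ∧
      sol (fun n => r⁻¹ * g n) α (fun n => r * β n) (fun _ => 0) u v (n + 1) * r ^ (n + 1)
      = sol g α β (fun _ => 0) u (r * v) (n + 1) from (h n).1
  intro n
  induction n with
  | zero => simp [mul_comm]
  | succ n ih =>
    refine ⟨ih.2, ?_⟩
    rw [sol_add_two, sol_add_two, ← ih.1, ← ih.2]
    by_cases h : β n = 0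
    · simp [h]
    · field_simp
      ring

theorem mem_spectrum_iff_det_eq_zero {k : ℕ} {z : ℂ} {A : Matrix (Fin k) (Fin k) ℂ} :
    z ∈ spectrum ℂ A ↔ (A - Matrix.scalar (Fin k) z).det = 0 := by
  rw [spectrum.mem_iff, ← IsUnit.neg_iff, neg_sub, Matrix.isUnit_iff_isUnit_det,
    isUnit_iff_ne_zero, not_not]
  rfl

theorem mem_spectrum_iff_exists_mulVec {k : ℕ} {z : ℂ} {A : Matrix (Fin k) (Fin k) ℂ} :
    z ∈ spectrum ℂ A ↔ ∃ v ≠ 0, A.mulVec v = z • v := by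
  rw [mem_spectrum_iff_det_eq_zero, ← Matrix.exists_mulVec_eq_zero_iff]
  refine exists_congr fun v => and_congr_right fun _ => ?_
  rw [Matrix.sub_mulVec, sub_eq_zero]
  simp [Matrix.scalar_apply, funext_iff]

theorem sum_ite_val_eq {k : ℕ} (m : ℕ) (F : ℕ → ℂ) :
    ∑ i : Fin k, (if (i : ℕ) = m then F i else 0) = if m < k then F m else 0 := by
  rw [Fin.sum_univ_eq_sum_range (fun i => if i = m then F i else 0) k, Finset.sum_ite_eq']
  simp

section

variable {k : ℕ} [NeZero k] {a b c : Fin k → ℂ} {z w₁ w₂ : ℂ}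

theorem IsMultiplierPair.scale (h : IsMultiplierPair a b c z w₁ w₂) {r : ℂ} (hr : r ≠ 0) :
    IsMultiplierPair a (r • b) (r⁻¹ • c) z (w₁ / r ^ k) (w₂ / r ^ k) := by
  have e1 : perSeqPred (r⁻¹ • c) = fun n => r⁻¹ * perSeqPred c n := rfl
  have e2 : perSeq (r • b) = fun n => r * perSeq b n := rfl
  constructor
  · have h1 : phi a (r • b) (r⁻¹ • c) z k * r ^ k = phi a b c z k := by
      rw [phi, phi, solOne, solOne, e1, e2, sol_scale hr, mul_zero]
    have h2 : psi a (r • b) (r⁻¹ • c) z (k + 1) * r ^ (k + 1) = r * psi a b c z (k + 1) := by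
      rw [psi, psi, solTwo, e1, e2, sol_scale hr, sol_homogeneous]
      ring
    have h3 : psi a (r • b) (r⁻¹ • c) z (k + 1) * r ^ k = psi a b c z (k + 1) := by
      refine mul_left_cancel₀ hr ?_
      rw [← h2]
      ring
    rw [← add_div, h.add, ← h1, ← h3]
    field_simp
  · simp only [Pi.smul_apply, smul_eq_mul, Finset.prod_mul_distrib, Finset.prod_const,
      Finset.card_univ, Fintype.card_fin, div_mul_div_comm, h.mul,
      inv_pow]
    field_simp

open Filter Topology in
theorem IsMultiplierPair.mem_spectrum_of_le_one (hb : ∀ j, b j ≠ 0)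
    (h : IsMultiplierPair a b c z w₁ w₂) (h₁ : ‖w₁‖ ≤ 1) (h₂ : ‖w₂‖ ≤ 1) :
    z ∈ spectrum ℂ (toeplitz a b c) := by
  refine mem_spectrum_toeplitz_of_frequently ?_
  have hev : ∀ᶠ r : ℝ in 𝓝[>] 1, z ∈ spectrum ℂ (toeplitz a ((r : ℂ) • b) ((r : ℂ)⁻¹ • c)) := by
    filter_upwards [self_mem_nhdsWithin] with r (hr : 1 < r)
    have hr0 : (r : ℂ) ≠ 0 := by exact_mod_cast (by linarith : r ≠ 0)
    have hk : ∀ w : ℂ, ‖w‖ ≤ 1 → ‖w / (r : ℂ) ^ k‖ < 1 := fun w hw => by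
      rw [norm_div, norm_pow, Complex.norm_real, Real.norm_of_nonneg (by linarith),
        div_lt_one (by positivity)]
      exact hw.trans_lt (one_lt_pow₀ hr (NeZero.ne k))
    exact (h.scale hr0).mem_spectrum_of_lt_one (fun j => mul_ne_zero hr0 (hb j)) (hk _ h₁) (hk _ h₂)
  exact hev.frequently.filter_mono nhdsWithin_le_nhds

open Filter Topology in
theorem IsMultiplierPair.mem_spectrum_of_one_le (hb : ∀ j, b j ≠ 0) (hc : ∀ j, c j ≠ 0)
    (h : IsMultiplierPair a b c z w₁ w₂) (h₁ : 1 ≤ ‖w₁‖) (h₂ : 1 ≤ ‖w₂‖) :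
    z ∈ spectrum ℂ (toeplitz a b c) := by
  refine mem_spectrum_toeplitz_of_frequently ?_
  have hev : ∀ᶠ r : ℝ in 𝓝[<] 1, z ∈ spectrum ℂ (toeplitz a ((r : ℂ) • b) ((r : ℂ)⁻¹ • c)) := by
    filter_upwards [Ioo_mem_nhdsLT one_pos] with r hr
    obtain ⟨hr0', hr1⟩ := hr
    have hr0 : (r : ℂ) ≠ 0 := by exact_mod_cast hr0'.ne'
    have hk : ∀ w : ℂ, 1 ≤ ‖w‖ → 1 < ‖w / (r : ℂ) ^ k‖ := fun w hw => by
      rw [norm_div, norm_pow, Complex.norm_real, Real.norm_of_nonneg hr0'.le,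
        one_lt_div (by positivity)]
      exact (pow_lt_one₀ hr0'.le hr1 (NeZero.ne k)).trans_le hw
    exact (h.scale hr0).mem_spectrum_of_one_lt (fun j => mul_ne_zero hr0 (hb j))
      (fun j => mul_ne_zero (inv_ne_zero hr0) (hc j)) (hk _ h₁) (hk _ h₂)
  exact hev.frequently.filter_mono nhdsWithin_le_nhds

theorem exists_isMultiplierPair (a b c : Fin k → ℂ) (z : ℂ) :
    ∃ w₁ w₂, IsMultiplierPair a b c z w₁ w₂ := by
  obtain ⟨s, hs⟩ := IsAlgClosed.exists_pow_nat_eq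
    (discrim 1 (-(phi a b c z k + psi a b c z (k + 1))) ((∏ j, c j) / ∏ j, b j)) two_pos
  obtain ⟨w, hw⟩ := exists_quadratic_eq_zero one_ne_zero ⟨s, by rw [← hs, sq]⟩
  exact ⟨w, phi a b c z k + psi a b c z (k + 1) - w, by ring, by linear_combination -hw⟩

/-! ### The symbol acting on quasiperiodic sequences -/

theorem blockUpper_mulVec (b : Fin k → ℂ) (x : ℕ → ℂ) (j : Fin k) :
    (blockUpper b).mulVec (fun i => x (i + 1)) j = if (j : ℕ) + 1 = k then b j * x 1 else 0 := by
  have h := sum_ite_val_eq (k := k) 0 fun i => if (j : ℕ) + 1 = k then b j * x (i + 1) else 0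
  rw [if_pos (Nat.pos_of_neZero k), zero_add] at h
  rw [← h, Matrix.mulVec, dotProduct]
  refine Finset.sum_congr rfl fun i _ => ?_
  simp only [blockUpper, Matrix.of_apply]
  split_ifs <;> simp_all

theorem blockLower_mulVec (c : Fin k → ℂ) (x : ℕ → ℂ) (j : Fin k) :
    (blockLower c).mulVec (fun i => x (i + 1)) j
      = if (j : ℕ) = 0 then perSeqPred c j * x k else 0 := by
  have hk := Nat.pos_of_neZero k
  have h := sum_ite_val_eq (k := k) (k - 1) fun i =>
    if (j : ℕ) = 0 then perSeq c i * x (i + 1) else 0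
  rw [if_pos (by omega), Nat.sub_add_cancel hk, ← perSeqPred_zero] at h
  have h' : (if (j : ℕ) = 0 then perSeqPred c j * x k else 0)
      = if (j : ℕ) = 0 then perSeqPred c 0 * x k else 0 := by
    split_ifs with hj
    · rw [hj]
    · rfl
  rw [h', ← h, Matrix.mulVec, dotProduct]
  refine Finset.sum_congr rfl fun i _ => ?_
  simp only [blockLower, Matrix.of_apply, perSeq_val]
  have : (i : ℕ) = k - 1 ↔ (i : ℕ) + 1 = k := by omega
  simp only [this]
  split_ifs <;> simp_all

theorem blockZero_mulVec (a b c : Fin k → ℂ) (x : ℕ → ℂ) (j : Fin k) :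
    (blockZero a b c).mulVec (fun i => x (i + 1)) j
      = a j * x (j + 1) + (if (j : ℕ) + 1 = k then 0 else b j * x (j + 2))
        + (if (j : ℕ) = 0 then 0 else perSeqPred c j * x j) := by
  have h1 := sum_ite_val_eq (k := k) j fun i => perSeq a i * x (i + 1)
  have h2 := sum_ite_val_eq (k := k) (j + 1) fun i => b j * x (i + 1)
  have h3 : ∑ i : Fin k, (if (j : ℕ) = i + 1 then perSeq c i * x (i + 1) else 0)
      = if (j : ℕ) = 0 then 0 else perSeqPred c j * x j := by
    split_ifs with hj
    · exact Finset.sum_eq_zero fun i _ => by rw [if_neg (by omega)]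
    · obtain ⟨m, hm⟩ := Nat.exists_eq_succ_of_ne_zero hj
      have h := sum_ite_val_eq (k := k) m fun i => perSeq c i * x (i + 1)
      rw [if_pos (by omega)] at h
      rw [hm, Nat.succ_eq_add_one, perSeqPred_succ, ← h]
      refine Finset.sum_congr rfl fun i _ => ?_
      simp only [Nat.add_right_cancel_iff, eq_comm]
  rw [if_pos j.2] at h1
  have h2' : (if (j : ℕ) + 1 < k then b j * x (j + 1 + 1) else 0)
      = if (j : ℕ) + 1 = k then 0 else b j * x (j + 2) := by
    have := j.2
    by_cases hj : (j : ℕ) + 1 = k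
    · simp [hj]
    · rw [if_neg hj, if_pos (by omega)]
  rw [h2'] at h2
  rw [← h3, ← h2, ← perSeq_val a, ← h1, ← Finset.sum_add_distrib, ← Finset.sum_add_distrib,
    Matrix.mulVec, dotProduct]
  refine Finset.sum_congr rfl fun i _ => ?_
  simp only [blockZero, Matrix.of_apply, perSeq_val, Fin.ext_iff]
  by_cases e1 : (j : ℕ) = i
  · obtain rfl : j = i := Fin.ext e1
    simp
  · by_cases e2 : (j : ℕ) + 1 = i
    · simp [e1, e2, show ¬ (i : ℕ) = j by omega, show ¬ (j : ℕ) = i + 1 by omega]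
    · simp [e1, e2, show ¬ (i : ℕ) = j by omega, show ¬ (i : ℕ) = j + 1 by omega,
        eq_comm (a := (j : ℕ))]

/-- On a quasiperiodic sequence the symbol acts as the three-term recurrence. -/
theorem symbol_mulVec (a b c : Fin k → ℂ) {w : ℂ} (hw : w ≠ 0) {x : ℕ → ℂ}
    (h₀ : x k = w * x 0) (h₁ : x (k + 1) = w * x 1) (j : Fin k) :
    (symbol a b c w⁻¹).mulVec (fun i => x (i + 1)) j
      = perSeqPred c j * x j + a j * x (j + 1) + b j * x (j + 2) := by
  rw [symbol, Matrix.add_mulVec, Matrix.add_mulVec, Matrix.smul_mulVec, Matrix.smul_mulVec]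
  simp only [Pi.add_apply, Pi.smul_apply, blockUpper_mulVec, blockZero_mulVec, blockLower_mulVec,
    inv_inv, smul_eq_mul]
  -- The two corner entries of the symbol supply the neighbours `x 0` and `x (k + 1)` that the
  -- diagonal block misses in its first and last rows.
  have e1 : (if (j : ℕ) = 0 then 0 else perSeqPred c j * x j)
      + w⁻¹ * (if (j : ℕ) = 0 then perSeqPred c j * x k else 0) = perSeqPred c j * x j := by
    split_ifs with h
    · rw [h₀, h]
      field_simp
      ring
    · ring
  have e2 : w * (if (j : ℕ) + 1 = k then b j * x 1 else 0)
      + (if (j : ℕ) + 1 = k then 0 else b j * x (j + 2)) = b j * x (j + 2) := by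
    split_ifs with h
    · rw [show (j : ℕ) + 2 = k + 1 by omega, h₁]
      ring
    · ring
  linear_combination e1 + e2

end

section

variable {k : ℕ} [NeZero k] {a b c : Fin k → ℂ} {z w : ℂ}

theorem exists_initial_of_mem_spectrum_symbol (hb : ∀ j, b j ≠ 0) (hw : w ≠ 0)
    (hz : z ∈ spectrum ℂ (symbol a b c w⁻¹)) : ∃ u v : ℂ, (u ≠ 0 ∨ v ≠ 0) ∧
      w * u = u * phi a b c z k + v * psi a b c z k ∧
      w * v = u * phi a b c z (k + 1) + v * psi a b c z (k + 1) := by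
  have hk := Nat.pos_of_neZero k
  obtain ⟨v, hv, hzv⟩ := mem_spectrum_iff_exists_mulVec.1 hz
  -- The eigenvector fills places `1, …, k`; one quasiperiodic entry is added at each end, so that
  -- rows `0, …, k - 1` obey the recurrence.
  let x : ℕ → ℂ := fun n => if n = 0 then w⁻¹ * perSeq v (k - 1) else
    if n ≤ k then perSeq v (n - 1) else w * perSeq v (n - 1)
  have hxv : (fun i : Fin k => x (i + 1)) = v := by
    funext i
    have : (i : ℕ) + 1 ≤ k := i.2
    simp [x, this, perSeq_val]
  have h₀ : x k = w * x 0 := by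
    simp [x, hk.ne', hw]
  have h₁ : x (k + 1) = w * x 1 := by
    have : perSeq v k = perSeq v 0 := by simpa using perSeq_periodic v 0
    simp [x, Nat.one_le_iff_ne_zero, hk.ne', this]
  have hrow : ∀ n < k, perSeqPred c n * x n + (perSeq a n - z) * x (n + 1)
      + perSeq b n * x (n + 2) = (fun _ => (0 : ℂ)) n := by
    intro n hn
    have h := symbol_mulVec a b c hw h₀ h₁ ⟨n, hn⟩
    rw [hxv, hzv] at h
    have hvn : v ⟨n, hn⟩ = x (n + 1) := (congrFun hxv ⟨n, hn⟩).symm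
    have ha : perSeq a n = a ⟨n, hn⟩ := perSeq_val a ⟨n, hn⟩
    have hbn : perSeq b n = b ⟨n, hn⟩ := perSeq_val b ⟨n, hn⟩
    simp only [Pi.smul_apply, smul_eq_mul, hvn] at h
    rw [ha, hbn]
    linear_combination -h
  have hsol : ∀ n ≤ k + 1, x n = x 0 * phi a b c z n + x 1 * psi a b c z n := fun n hn => by
    rw [eq_sol_of_le (perSeq_ne_zero hb) hrow hn, sol_homogeneous]
    rfl
  refine ⟨x 0, x 1, ?_, by rw [← h₀, hsol k (by omega)], by rw [← h₁, hsol (k + 1) le_rfl]⟩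
  by_contra! hcon
  refine hv (funext fun i => ?_)
  rw [← hxv]
  change x (i + 1) = 0
  rw [hsol _ (by omega), hcon.1, hcon.2]
  simp

theorem mem_spectrum_symbol_of_initial {u v : ℂ} (hb : ∀ j, b j ≠ 0) (hw : w ≠ 0)
    (huv : u ≠ 0 ∨ v ≠ 0)
    (h₀ : w * u = u * phi a b c z k + v * psi a b c z k)
    (h₁ : w * v = u * phi a b c z (k + 1) + v * psi a b c z (k + 1)) :
    z ∈ spectrum ℂ (symbol a b c w⁻¹) := by
  have hk := Nat.pos_of_neZero k
  let x : ℕ → ℂ := sol (perSeqPred c) (fun n => perSeq a n - z) (perSeq b) (fun _ => 0) u v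
  have hs : IsBulkSol a b c z (fun _ => 0) x := isSol_sol (perSeq_ne_zero hb) u v
  have hx₀ : x k = w * x 0 := (sol_homogeneous u v k).trans h₀.symm
  have hx₁ : x (k + 1) = w * x 1 := (sol_homogeneous u v (k + 1)).trans h₁.symm
  refine mem_spectrum_iff_exists_mulVec.2 ⟨fun i => x (i + 1), fun h => ?_, funext fun j => ?_⟩
  · have hx : ∀ n < k, x (n + 1) = 0 := fun n hn => congrFun h ⟨n, hn⟩
    have hv : v = 0 := hx 0 hk
    have hu : u = 0 := by
      have := hx (k - 1) (by omega)
      rw [Nat.sub_add_cancel hk, hx₀] at this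
      exact (mul_eq_zero.1 this).resolve_left hw
    simp [hu, hv] at huv
  · have h := hs j
    rw [symbol_mulVec a b c hw hx₀ hx₁]
    simp only [perSeq_val] at h
    simp only [Pi.smul_apply, smul_eq_mul]
    linear_combination h

/-- The spectrum of the symbol in terms of the Floquet multipliers. -/
theorem IsMultiplierPair.mem_spectrum_symbol_iff {w₁ w₂ ζ : ℂ} (hb : ∀ j, b j ≠ 0)
    (h : IsMultiplierPair a b c z w₁ w₂) (hζ : ζ ≠ 0) :
    z ∈ spectrum ℂ (symbol a b c ζ) ↔ ζ⁻¹ = w₁ ∨ ζ⁻¹ = w₂ := by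
  obtain ⟨w, rfl⟩ : ∃ w, ζ = w⁻¹ := ⟨ζ⁻¹, (inv_inv ζ).symm⟩
  have hw : w ≠ 0 := by simpa using hζ
  rw [inv_inv, ← sub_eq_zero, ← sub_eq_zero (a := w) (b := w₂), ← mul_eq_zero]
  have hadd := h.add
  have hmul := h.mul_eq hb
  constructor
  · intro hz
    obtain ⟨u, v, huv, h₀, h₁⟩ := exists_initial_of_mem_spectrum_symbol hb hw hz
    rcases huv with hu | hv
    -- Applying the adjugate of monodromy minus `w` to the eigenvector equations shows that `(w -
    -- w₁) * (w - w₂)` annihilates both `u` and `v`.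
    · refine (mul_eq_zero.1 ?_).resolve_left hu
      linear_combination u * hmul - w * u * hadd + (w - psi a b c z (k + 1)) * h₀
        + psi a b c z k * h₁
    · refine (mul_eq_zero.1 ?_).resolve_left hv
      linear_combination v * hmul - w * v * hadd + (w - phi a b c z k) * h₁
        + phi a b c z (k + 1) * h₀
  · intro hroot
    have hdet : (!![phi a b c z k - w, psi a b c z k;
        phi a b c z (k + 1), psi a b c z (k + 1) - w]).det = 0 := by
      rw [Matrix.det_fin_two_of]
      linear_combination hroot - hmul + w * hadd
    obtain ⟨v, hv, hv'⟩ := Matrix.exists_mulVec_eq_zero_iff.2 hdet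
    have e₀ := congrFun hv' 0
    have e₁ := congrFun hv' 1
    simp [Matrix.mulVec, dotProduct, Fin.sum_univ_two] at e₀ e₁
    refine mem_spectrum_symbol_of_initial (u := v 0) (v := v 1) hb hw ?_
      (by linear_combination -e₀) (by linear_combination -e₁)
    by_contra! hcon
    refine hv (funext fun i => ?_)
    fin_cases i
    · exact hcon.1
    · exact hcon.2

open Polynomial in
-- Each step of the recurrence raises the degree in `z` by one, the leading coefficient being
-- divided by a nonzero entry of `b` up to sign. Two consecutive terms are carried for the
-- induction.
theorem exists_polynomial_psi (hb : ∀ j, b j ≠ 0) (n : ℕ) : ∃ p q : ℂ[X],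
    (∀ z, p.eval z = psi a b c z n) ∧ (∀ z, q.eval z = psi a b c z (n + 1)) ∧
    p.degree < n ∧ q.degree = n := by
  induction n with
  | zero => exact ⟨0, 1, by simp [psi, solTwo], by simp [psi, solTwo], by simp, by simp⟩
  | succ n ih =>
    obtain ⟨p, q, hp, hq, hpd, hqd⟩ := ih
    have hbn := perSeq_ne_zero hb n
    refine ⟨q, C (perSeq b n)⁻¹ * ((X - C (perSeq a n)) * q - C (perSeqPred c n) * p), hq,
      fun z => ?_, by rw [hqd]; exact_mod_cast Nat.lt_succ_self n, ?_⟩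
    · have : psi a b c z (n + 2) = (0 - perSeqPred c n * psi a b c z n
          - (perSeq a n - z) * psi a b c z (n + 1)) / perSeq b n := rfl
      rw [this, ← hp, ← hq]
      simp only [eval_mul, eval_sub, eval_C, eval_X]
      field_simp
      ring
    · have h1 : ((X - C (perSeq a n)) * q).degree = ((n + 1 : ℕ) : WithBot ℕ) := by
        rw [degree_mul, degree_X_sub_C, hqd]
        push_cast
        ring
      rw [degree_C_mul (inv_ne_zero hbn), degree_sub_eq_left_of_degree_lt, h1]
      rw [h1]
      rw [← smul_eq_C_mul]
      refine (degree_smul_le _ _).trans_lt (hpd.trans ?_)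
      exact_mod_cast Nat.lt_succ_self n

/-- The zeros are the eigenvalues of the leading `(k - 1) × (k - 1)` truncation; here they are only
counted, through the degree. -/
theorem encard_psi_eq_zero_le (hb : ∀ j, b j ≠ 0) :
    {z | psi a b c z k = 0}.encard ≤ ((k - 1 : ℕ) : ℕ∞) := by
  obtain ⟨-, q, -, hq, -, hqd⟩ := exists_polynomial_psi (a := a) (c := c) hb (k - 1)
  rw [Nat.sub_add_cancel (Nat.pos_of_neZero k)] at hq
  have hq0 : q ≠ 0 := by
    rintro rfl
    simp at hqd
  have hsub : {z | psi a b c z k = 0} ⊆ (q.roots.toFinset : Set ℂ) := fun z hz => by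
    simpa [hq0, Polynomial.IsRoot, hq] using hz
  refine (Set.encard_le_encard hsub).trans ?_
  rw [Set.encard_coe_eq_coe_finsetCard]
  exact_mod_cast (Multiset.toFinset_card_le _).trans
    ((Polynomial.card_roots' q).trans (Polynomial.natDegree_eq_of_degree_eq_some hqd).le)

end

/-! ### The characteristic determinant of the symbol -/

theorem det_add_single {n : ℕ} (A : Matrix (Fin n) (Fin n) ℂ) (i j : Fin n) (s : ℂ) :
    (A + Matrix.single i j s).det = A.det + s * A.adjugate j i := by
  have h : A + Matrix.single i j s = A.updateRow i (A i + s • Pi.single j 1) := by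
    ext p q
    by_cases hp : p = i
    · subst hp
      by_cases hq : q = j
      · subst hq
        simp
      · simp [hq, Ne.symm hq]
    · simp [hp, Ne.symm hp]
  rw [h, Matrix.det_updateRow_add, Matrix.det_updateRow_smul, Matrix.updateRow_eq_self,
    Matrix.adjugate_apply]

/-- The determinant of a matrix with perturbed corners is affine in each of the perturbations. -/
theorem exists_det_add_corners {n : ℕ} (hn : n ≠ 0) (A : Matrix (Fin (n + 1)) (Fin (n + 1)) ℂ) :
    ∃ D : ℂ, ∀ s t : ℂ,
      (A + Matrix.single (Fin.last n) 0 t + Matrix.single 0 (Fin.last n) s).det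
        = A.det + s * A.adjugate (Fin.last n) 0 + t * A.adjugate 0 (Fin.last n) + s * t * D := by
  have hne : (Fin.last n : Fin (n + 1)) ≠ 0 := by
    simpa [Fin.ext_iff] using hn
  -- The coefficient of `s * t` is the determinant with row 0 replaced by the last unit vector and
  -- the last row by the first one. The rows must differ, hence `n ≠ 0`.
  refine ⟨(A.updateRow 0 (Pi.single (Fin.last n) 1)).adjugate 0 (Fin.last n), fun s t => ?_⟩
  have h : (A + Matrix.single (Fin.last n) 0 t).updateRow 0 (Pi.single (Fin.last n) 1)
      = A.updateRow 0 (Pi.single (Fin.last n) 1) + Matrix.single (Fin.last n) 0 t := by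
    ext p q
    by_cases hp : p = 0
    · subst hp
      simp [hne]
    · simp [hp]
  rw [det_add_single, det_add_single, Matrix.adjugate_apply (A + _), h, det_add_single,
    ← Matrix.adjugate_apply]
  ring

section

variable {n : ℕ} (a b c : Fin (n + 1) → ℂ) (z : ℂ)

/-- Deleting the first row and last column leaves an upper triangular matrix whose diagonal is the
former subdiagonal. -/
theorem adjugate_corner_lower :
    (blockZero a b c - Matrix.scalar (Fin (n + 1)) z).adjugate (Fin.last n) 0
      = (-1) ^ n * ∏ i : Fin n, c i.castSucc := by
  rw [Matrix.adjugate_fin_succ_eq_det_submatrix, Matrix.det_of_isUpperTriangular]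
  · simp only [Fin.succAbove_zero, Fin.succAbove_last, Matrix.submatrix_apply]
    congr 1
    · simp
    · refine Finset.prod_congr rfl fun i _ => ?_
      simp [blockZero, Matrix.scalar_apply, Fin.ext_iff]
      omega
  · intro i j hij
    have hij' : (j : ℕ) < i := hij
    have h1 : i.succ ≠ j.castSucc := by simp [Fin.ext_iff]; omega
    simp only [Fin.succAbove_zero, Fin.succAbove_last, Matrix.submatrix_apply]
    simp [blockZero, Matrix.scalar_apply, Matrix.diagonal_apply_ne _ h1, Fin.ext_iff]
    grind

theorem adjugate_corner_upper :
    (blockZero a b c - Matrix.scalar (Fin (n + 1)) z).adjugate 0 (Fin.last n)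
      = (-1) ^ n * ∏ i : Fin n, b i.castSucc := by
  rw [Matrix.adjugate_fin_succ_eq_det_submatrix, Matrix.det_of_isLowerTriangular]
  · simp only [Fin.succAbove_zero, Fin.succAbove_last, Matrix.submatrix_apply]
    congr 1
    refine Finset.prod_congr rfl fun i _ => ?_
    simp [blockZero, Matrix.scalar_apply, Fin.ext_iff]
  · intro i j hij
    have hij' : (i : ℕ) < j := hij
    have h1 : i.castSucc ≠ j.succ := by simp [Fin.ext_iff]; omega
    simp only [Fin.succAbove_zero, Fin.succAbove_last, Matrix.submatrix_apply]
    simp [blockZero, Matrix.scalar_apply, Matrix.diagonal_apply_ne _ h1, Fin.ext_iff]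
    grind

theorem symbol_eq_add_corners (ζ : ℂ) : symbol a b c ζ = blockZero a b c
    + Matrix.single (Fin.last n) 0 (ζ⁻¹ * b (Fin.last n))
    + Matrix.single 0 (Fin.last n) (ζ * c (Fin.last n)) := by
  have hu : blockUpper b = Matrix.single (Fin.last n) 0 (b (Fin.last n)) := by
    ext i j
    simp only [blockUpper, Matrix.of_apply, Matrix.single_apply, Fin.ext_iff, Fin.val_last,
      Fin.val_zero]
    grind
  have hl : blockLower c = Matrix.single 0 (Fin.last n) (c (Fin.last n)) := by
    ext i j
    simp only [blockLower, Matrix.of_apply, Matrix.single_apply, Fin.ext_iff, Fin.val_last,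
      Fin.val_zero]
    grind
  rw [symbol, hu, hl, Matrix.smul_single, Matrix.smul_single, smul_eq_mul, smul_eq_mul]
  abel

end

/-- The characteristic determinant of the symbol as a Laurent polynomial. -/
theorem exists_det_symbol_sub {k : ℕ} [NeZero k] (a b c : Fin k → ℂ) (z : ℂ) :
    ∃ G : ℂ, ∀ ζ : ℂ, ζ ≠ 0 → (symbol a b c ζ - Matrix.scalar (Fin k) z).det
      = (-1) ^ (k + 1) * ((∏ j, c j) * ζ + (∏ j, b j) * ζ⁻¹) + G := by
  obtain _ | n := k
  · exact absurd rfl (NeZero.ne 0)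
  -- For `k = 1` both corners coincide with the single diagonal entry.
  rcases eq_or_ne n 0 with rfl | hn
  · refine ⟨a 0 - z, fun ζ _ => ?_⟩
    rw [Matrix.det_fin_one]
    simp [symbol, blockUpper, blockLower, blockZero]
    ring
  · obtain ⟨D, hD⟩ := exists_det_add_corners hn (blockZero a b c - Matrix.scalar (Fin (n + 1)) z)
    -- The term containing both corners is independent of `ζ`, because `ζ * ζ⁻¹ = 1`, so it joins
    -- the constant.
    refine ⟨(blockZero a b c - Matrix.scalar (Fin (n + 1)) z).det
      + c (Fin.last n) * b (Fin.last n) * D, fun ζ hζ => ?_⟩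
    have h : symbol a b c ζ - Matrix.scalar (Fin (n + 1)) z
        = blockZero a b c - Matrix.scalar (Fin (n + 1)) z
          + Matrix.single (Fin.last n) 0 (ζ⁻¹ * b (Fin.last n))
          + Matrix.single 0 (Fin.last n) (ζ * c (Fin.last n)) := by
      rw [symbol_eq_add_corners]
      abel
    rw [h, hD, adjugate_corner_lower, adjugate_corner_upper, Fin.prod_univ_castSucc c,
      Fin.prod_univ_castSucc b]
    field_simp
    ring

/-! ### Orders of zeros of exponential pairs -/

section

variable {A B G s : ℂ}

theorem hasDerivAt_expPair (A B G s w : ℂ) :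
    HasDerivAt (fun w => A * Complex.exp (s * w) + B * Complex.exp (-(s * w)) + G)
      (s * A * Complex.exp (s * w) + -(s * B) * Complex.exp (-(s * w)) + 0) w := by
  have h1 : HasDerivAt (fun w => s * w) s w := by simpa using (hasDerivAt_id w).const_mul s
  exact (((h1.cexp.const_mul A).add (h1.neg.cexp.const_mul B)).add_const G).congr_deriv
    (by simp only [Pi.neg_apply]; ring)

theorem analyticOrderAt_expPair_eq_one {w : ℂ} (hs : s ≠ 0)
    (h0 : A * Complex.exp (s * w) + B * Complex.exp (-(s * w)) + G = 0)
    (h1 : A * Complex.exp (s * w) ≠ B * Complex.exp (-(s * w))) :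
    analyticOrderAt (fun w => A * Complex.exp (s * w) + B * Complex.exp (-(s * w)) + G) w = 1 := by
  refine AnalyticAt.analyticOrderAt_eq_one_of_zero_deriv_ne_zero (by fun_prop) h0 ?_
  rw [(hasDerivAt_expPair A B G s w).deriv]
  intro h
  refine h1 (mul_left_cancel₀ hs ?_)
  linear_combination h

/-- The derivative is again an exponential pair, with coefficients `s * A`, `-(s * B)` and constant
0. It has a simple zero here, so the order is one more. -/
theorem analyticOrderAt_expPair_eq_two {w : ℂ} (hs : s ≠ 0) (hA : A ≠ 0)
    (h0 : A * Complex.exp (s * w) + B * Complex.exp (-(s * w)) + G = 0)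
    (h1 : A * Complex.exp (s * w) = B * Complex.exp (-(s * w))) :
    analyticOrderAt (fun w => A * Complex.exp (s * w) + B * Complex.exp (-(s * w)) + G) w = 2 := by
  have h := AnalyticAt.analyticOrderAt_deriv_add_one (x := w)
    (f := fun w => A * Complex.exp (s * w) + B * Complex.exp (-(s * w)) + G) (by fun_prop)
  rw [funext fun w => (hasDerivAt_expPair A B G s w).deriv, h0,
    analyticOrderAt_expPair_eq_one hs] at h
  · simpa [one_add_one_eq_two] using h.symm
  · linear_combination s * h1
  · intro h2
    have h3 : 2 * s * A * Complex.exp (s * w) = 0 := by linear_combination h2 + s * h1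
    simp [hs, hA] at h3

end

/-! ### Quasiperiodicities and phase factors -/

section

variable {L : ℝ}

/-- The phase factor `e^{-iLκ}` of a quasiperiodicity. -/
def bloch (L : ℝ) (κ : ℂ) : ℂ := Complex.exp (-Complex.I * L * κ)

theorem bloch_ne_zero (L : ℝ) (κ : ℂ) : bloch L κ ≠ 0 := Complex.exp_ne_zero _

theorem norm_bloch (L : ℝ) (κ : ℂ) : ‖bloch L κ‖ = Real.exp (L * κ.im) := by
  rw [bloch, Complex.norm_exp]
  simp

theorem exists_bloch_eq (hL : 0 < L) {ζ : ℂ} (hζ : ζ ≠ 0) :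
    ∃ κ : ℂ, κ.re ∈ Set.Ico (-Real.pi / L) (Real.pi / L) ∧ bloch L κ = ζ := by
  have hL' : (L : ℂ) ≠ 0 := by exact_mod_cast hL.ne'
  -- The argument lies in `(-π, π]`; its negative lies in `[-π, π)`, matching the half-open strip.
  refine ⟨⟨-ζ.arg / L, Real.log ‖ζ‖ / L⟩, ⟨?_, ?_⟩, ?_⟩
  · exact div_le_div_of_nonneg_right (neg_le_neg (Complex.arg_le_pi ζ)) hL.le
  · exact div_lt_div_of_pos_right (by linarith [Complex.neg_pi_lt_arg ζ]) hL
  · have h : -Complex.I * L * (⟨-ζ.arg / L, Real.log ‖ζ‖ / L⟩ : ℂ) = Complex.log ζ := by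
      apply Complex.ext
      · simp
        field_simp
        simp [Complex.log_re]
      · simp
        field_simp
        simp [Complex.log_im]
    rw [bloch, h, Complex.exp_log hζ]

theorem bloch_injOn (hL : 0 < L) {κ κ' : ℂ} (hκ : κ.re ∈ Set.Ico (-Real.pi / L) (Real.pi / L))
    (hκ' : κ'.re ∈ Set.Ico (-Real.pi / L) (Real.pi / L)) (h : bloch L κ = bloch L κ') :
    κ = κ' := by
  obtain ⟨n, hn⟩ := Complex.exp_eq_exp_iff_exists_int.1 h
  have hre := congrArg Complex.re hn
  have him := congrArg Complex.im hn
  simp at hre him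
  rw [Set.mem_Ico, div_le_iff₀ hL, lt_div_iff₀ hL] at hκ hκ'
  have hpi := Real.pi_pos
  have hn0 : n = 0 := by
    have h1 : (n : ℝ) < 1 := by nlinarith
    have h2 : (-1 : ℝ) < n := by nlinarith
    have h3 : n < 1 := by exact_mod_cast h1
    have h4 : -1 < n := by exact_mod_cast h2
    omega
  subst hn0
  apply Complex.ext
  · simpa [hL.ne'] using him
  · rcases hre with h | h
    · exact h
    · exact absurd h hL.ne'

end

section

variable {k : ℕ} {b c : Fin k → ℂ}

theorem prod_ne_zero_of_forall {d : Fin k → ℂ} (hd : ∀ j, d j ≠ 0) : ∏ j, d j ≠ 0 :=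
  Finset.prod_ne_zero_iff.2 fun j _ => hd j

theorem exp_nonReciprocityRate (hb : ∀ j, b j ≠ 0) (hc : ∀ j, c j ≠ 0) :
    Real.exp (nonReciprocityRate b c) = ‖(∏ j, b j) / ∏ j, c j‖ := by
  rw [nonReciprocityRate, ← norm_prod, Finset.prod_div_distrib, Real.exp_log]
  exact norm_pos_iff.2 (div_ne_zero (prod_ne_zero_of_forall hb) (prod_ne_zero_of_forall hc))

theorem exp_nonReciprocityRate_add (hb : ∀ j, b j ≠ 0) (hc : ∀ j, c j ≠ 0) :
    Complex.exp (nonReciprocityRate b c + phaseShift b c * Complex.I)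
      = (∏ j, b j) / ∏ j, c j := by
  rw [Complex.exp_add, ← Complex.ofReal_exp, exp_nonReciprocityRate hb hc, phaseShift,
    Finset.prod_div_distrib, Complex.norm_mul_exp_arg_mul_I]

end

/-! ### Conjugate pairs of quasiperiodicities -/

section

variable {k : ℕ} [NeZero k] {a b c : Fin k → ℂ} {L : ℝ} {z w₁ w₂ : ℂ}

theorem IsMultiplierPair.symm (h : IsMultiplierPair a b c z w₁ w₂) :
    IsMultiplierPair a b c z w₂ w₁ :=
  ⟨by rw [add_comm, h.add], by rw [mul_comm, h.mul]⟩

theorem IsMultiplierPair.fst_ne_zero (hb : ∀ j, b j ≠ 0) (hc : ∀ j, c j ≠ 0)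
    (h : IsMultiplierPair a b c z w₁ w₂) : w₁ ≠ 0 := by
  have h1 : w₁ * w₂ ≠ 0 := by
    rw [h.mul]
    exact div_ne_zero (prod_ne_zero_of_forall hc) (prod_ne_zero_of_forall hb)
  exact left_ne_zero_of_mul h1

/-- `κ` and `κ'` in the strip are conjugate quasiperiodicities of `z`. -/
structure IsQuasiPair (a b c : Fin k → ℂ) (L : ℝ) (z κ κ' : ℂ) : Prop where
  pair : IsMultiplierPair a b c z (bloch L κ)⁻¹ (bloch L κ')⁻¹
  fst_re : κ.re ∈ Set.Ico (-Real.pi / L) (Real.pi / L)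
  snd_re : κ'.re ∈ Set.Ico (-Real.pi / L) (Real.pi / L)

namespace IsQuasiPair

variable {κ κ' : ℂ}

theorem symm (h : IsQuasiPair a b c L z κ κ') : IsQuasiPair a b c L z κ' κ :=
  ⟨h.pair.symm, h.snd_re, h.fst_re⟩

theorem bloch_mul (h : IsQuasiPair a b c L z κ κ') :
    bloch L κ * bloch L κ' = (∏ j, b j) / ∏ j, c j := by
  have := h.pair.mul
  rw [← mul_inv, inv_eq_iff_eq_inv, inv_div] at this
  exact this

theorem exists_int (h : IsQuasiPair a b c L z κ κ') (hb : ∀ j, b j ≠ 0) (hc : ∀ j, c j ≠ 0)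
    (hL : 0 < L) : κ'.im = nonReciprocityRate b c / L - κ.im ∧
      ∃ n : ℤ, κ'.re = -phaseShift b c / L - κ.re + n * (2 * Real.pi / L) := by
  have hm := h.bloch_mul
  rw [← exp_nonReciprocityRate_add hb hc, bloch, bloch, ← Complex.exp_add] at hm
  obtain ⟨n, hn⟩ := Complex.exp_eq_exp_iff_exists_int.1 hm
  have hre := congrArg Complex.re hn
  have him := congrArg Complex.im hn
  simp at hre him
  constructor
  · field_simp
    linarith
  · refine ⟨-n, ?_⟩
    push_cast
    field_simp
    linarith

theorem mem_spectrum_iff (h : IsQuasiPair a b c L z κ κ') (hb : ∀ j, b j ≠ 0) (hL : 0 < L)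
    {w : ℂ} (hw : w.re ∈ Set.Ico (-Real.pi / L) (Real.pi / L)) :
    z ∈ spectrum ℂ (blochSymbol a b c L w) ↔ w = κ ∨ w = κ' := by
  change z ∈ spectrum ℂ (symbol a b c (bloch L w)) ↔ _
  rw [h.pair.mem_spectrum_symbol_iff hb (bloch_ne_zero L w), inv_inj, inv_inj]
  refine or_congr ⟨bloch_injOn hL hw h.fst_re, ?_⟩ ⟨bloch_injOn hL hw h.snd_re, ?_⟩ <;>
  · rintro rfl
    rfl

theorem mul_bloch_eq (h : IsQuasiPair a b c L z κ κ') (hc : ∀ j, c j ≠ 0) :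
    (∏ j, c j) * bloch L κ' = (∏ j, b j) * (bloch L κ)⁻¹ := by
  have hC := prod_ne_zero_of_forall hc
  have h1 := bloch_ne_zero L κ
  have h2 := h.bloch_mul
  rw [eq_div_iff hC] at h2
  rw [← h2]
  field_simp

/-- For every `μ`, passing from `κ` to `κ'` exchanges the terms `∏ c · ζ` and `∏ b · ζ⁻¹` of the
characteristic determinant. -/
theorem spectrum_eq (h : IsQuasiPair a b c L z κ κ') (hc : ∀ j, c j ≠ 0) :
    spectrum ℂ (blochSymbol a b c L κ) = spectrum ℂ (blochSymbol a b c L κ') := by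
  ext μ
  obtain ⟨G, hG⟩ := exists_det_symbol_sub a b c μ
  change μ ∈ spectrum ℂ (symbol a b c (bloch L κ)) ↔ μ ∈ spectrum ℂ (symbol a b c (bloch L κ'))
  rw [mem_spectrum_iff_det_eq_zero, mem_spectrum_iff_det_eq_zero, hG _ (bloch_ne_zero L κ),
    hG _ (bloch_ne_zero L κ'), h.mul_bloch_eq hc, h.symm.mul_bloch_eq hc]
  ring_nf

theorem exists_blochDet_eq (a b c : Fin k → ℂ) (L : ℝ) (z : ℂ) : ∃ G : ℂ,
    blochDet a b c L z = fun w => (-1) ^ (k + 1) * (∏ j, c j) * Complex.exp (-Complex.I * L * w)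
      + (-1) ^ (k + 1) * (∏ j, b j) * Complex.exp (-(-Complex.I * L * w)) + G := by
  obtain ⟨G, hG⟩ := exists_det_symbol_sub a b c z
  refine ⟨G, funext fun w => ?_⟩
  rw [blochDet, blochSymbol, hG _ (Complex.exp_ne_zero _), Complex.exp_neg]
  ring

theorem blochDet_eq_zero (h : IsQuasiPair a b c L z κ κ') (hb : ∀ j, b j ≠ 0) (hL : 0 < L) :
    blochDet a b c L z κ = 0 :=
  mem_spectrum_iff_det_eq_zero.1 ((h.mem_spectrum_iff hb hL h.fst_re).2 (Or.inl rfl))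

theorem analyticOrderAt_eq_one (h : IsQuasiPair a b c L z κ κ') (hb : ∀ j, b j ≠ 0)
    (hc : ∀ j, c j ≠ 0) (hL : 0 < L) (hne : κ ≠ κ') :
    analyticOrderAt (blochDet a b c L z) κ = 1 := by
  have hL' : (L : ℂ) ≠ 0 := by exact_mod_cast hL.ne'
  have h0 := h.blochDet_eq_zero hb hL
  obtain ⟨G, hG⟩ := exists_blochDet_eq a b c L z
  rw [hG] at h0 ⊢
  refine analyticOrderAt_expPair_eq_one (by simp [hL']) h0 fun heq => hne ?_
  refine bloch_injOn hL h.fst_re h.snd_re ?_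
  refine mul_left_cancel₀ (prod_ne_zero_of_forall hc) ?_
  rw [h.mul_bloch_eq hc, bloch, ← Complex.exp_neg]
  refine mul_left_cancel₀ (pow_ne_zero (k + 1) (neg_ne_zero.2 one_ne_zero)) ?_
  rw [← mul_assoc, ← mul_assoc, heq]

theorem analyticOrderAt_eq_two (h : IsQuasiPair a b c L z κ κ) (hb : ∀ j, b j ≠ 0)
    (hc : ∀ j, c j ≠ 0) (hL : 0 < L) :
    analyticOrderAt (blochDet a b c L z) κ = 2 := by
  have hL' : (L : ℂ) ≠ 0 := by exact_mod_cast hL.ne'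
  have h0 := h.blochDet_eq_zero hb hL
  obtain ⟨G, hG⟩ := exists_blochDet_eq a b c L z
  rw [hG] at h0 ⊢
  refine analyticOrderAt_expPair_eq_two (by simp [hL'])
    (mul_ne_zero (by simp) (prod_ne_zero_of_forall hc)) h0 ?_
  have := h.mul_bloch_eq hc
  rw [bloch, ← Complex.exp_neg] at this
  linear_combination (-1) ^ (k + 1) * this

end IsQuasiPair

theorem exists_isQuasiPair (hb : ∀ j, b j ≠ 0) (hc : ∀ j, c j ≠ 0) (hL : 0 < L) (a : Fin k → ℂ)
    (z : ℂ) : ∃ κ κ', IsQuasiPair a b c L z κ κ' := by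
  obtain ⟨w₁, w₂, h⟩ := exists_isMultiplierPair a b c z
  obtain ⟨κ, hκ, e⟩ := exists_bloch_eq hL (inv_ne_zero (h.fst_ne_zero hb hc))
  obtain ⟨κ', hκ', e'⟩ := exists_bloch_eq hL (inv_ne_zero (h.symm.fst_ne_zero hb hc))
  exact ⟨κ, κ', by rwa [e, e', inv_inv, inv_inv], hκ, hκ'⟩

/-- The segment is invariant under `β ↦ Δ / L - β`, so testing either member of the pair suffices.
-/
theorem mem_blochSpectrum_iff {κ κ' : ℂ} (h : IsQuasiPair a b c L z κ κ') (hb : ∀ j, b j ≠ 0)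
    (hc : ∀ j, c j ≠ 0) (hL : 0 < L) :
    z ∈ blochSpectrum a b c L ↔ κ.im ∈ Set.uIcc 0 (nonReciprocityRate b c / L) := by
  have him := (h.exists_int hb hc hL).1
  simp only [blochSpectrum, Set.mem_iUnion]
  constructor
  · rintro ⟨w, ⟨hw, hw'⟩, hz⟩
    rcases (h.mem_spectrum_iff hb hL hw).1 hz with rfl | rfl
    · exact hw'
    · rw [him, Set.mem_uIcc] at hw'
      rw [Set.mem_uIcc]
      rcases hw' with h | h
      · exact Or.inl ⟨by linarith, by linarith⟩
      · exact Or.inr ⟨by linarith, by linarith⟩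
  · intro hκ
    exact ⟨κ, ⟨h.fst_re, hκ⟩, (h.mem_spectrum_iff hb hL h.fst_re).2 (Or.inl rfl)⟩

theorem blochSpectrum_subset (hb : ∀ j, b j ≠ 0) (hc : ∀ j, c j ≠ 0) (hL : 0 < L) :
    blochSpectrum a b c L ⊆ spectrum ℂ (toeplitz a b c) := by
  intro z hz
  obtain ⟨κ, κ', h⟩ := exists_isQuasiPair hb hc hL a z
  have him := (h.exists_int hb hc hL).1
  rw [mem_blochSpectrum_iff h hb hc hL, Set.mem_uIcc] at hz
  -- For `Δ ≥ 0` both multipliers lie in the closed unit disc; for `Δ ≤ 0` neither lies in the open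
  -- disc.
  rcases hz with hz | hz
  · refine h.pair.mem_spectrum_of_le_one hb ?_ ?_ <;>
    · rw [norm_inv, norm_bloch, ← Real.exp_neg, Real.exp_le_one_iff]
      nlinarith
  · refine h.pair.mem_spectrum_of_one_le hb hc ?_ ?_ <;>
    · rw [norm_inv, norm_bloch, ← Real.exp_neg, Real.one_le_exp_iff]
      nlinarith

/-- Off the segment, `κ.im` and `κ'.im` have strictly opposite signs, so the unit circle separates
the multipliers and only `psi a b c z k = 0` can prevent invertibility. -/
theorem spectrum_diff_subset (hb : ∀ j, b j ≠ 0) (hc : ∀ j, c j ≠ 0) (hL : 0 < L) :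
    spectrum ℂ (toeplitz a b c) \ blochSpectrum a b c L ⊆ {z | psi a b c z k = 0} := by
  rintro z ⟨hz, hzB⟩
  by_contra hne
  obtain ⟨κ, κ', h⟩ := exists_isQuasiPair hb hc hL a z
  have him := (h.exists_int hb hc hL).1
  rw [mem_blochSpectrum_iff h hb hc hL, Set.mem_uIcc] at hzB
  push Not at hzB
  have hlt : ∀ w : ℂ, 0 < w.im → ‖(bloch L w)⁻¹‖ < 1 := fun w hw => by
    rw [norm_inv, norm_bloch, ← Real.exp_neg, Real.exp_lt_one_iff]
    nlinarith
  have hgt : ∀ w : ℂ, w.im < 0 → 1 < ‖(bloch L w)⁻¹‖ := fun w hw => by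
    rw [norm_inv, norm_bloch, ← Real.exp_neg, Real.one_lt_exp_iff]
    nlinarith
  rcases lt_or_ge κ.im 0 with h0 | h0
  · have : 0 < κ'.im := by
      rw [him]
      by_contra! hcon
      linarith [hzB.2 (by linarith)]
    exact h.pair.symm.notMem_spectrum hb (hlt _ this) (hgt _ h0) hne hz
  · have h1 := hzB.1 h0
    have h2 : 0 < κ.im := by
      by_contra! hcon
      linarith [hzB.2 (by linarith)]
    exact h.pair.notMem_spectrum hb (hlt _ h2) (hgt _ (by rw [him]; linarith)) hne hz

/-- One quasiperiodicity of a point of the Bloch spectrum can be chosen in the half of the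
generalised Brillouin zone adjacent to the real axis. -/
theorem exists_isQuasiPair_half (hb : ∀ j, b j ≠ 0) (hc : ∀ j, c j ≠ 0) (hL : 0 < L)
    (hz : z ∈ blochSpectrum a b c L) : ∃ κ κ', IsQuasiPair a b c L z κ κ' ∧
      κ.im ∈ Set.uIcc 0 (nonReciprocityRate b c / (2 * L)) := by
  obtain ⟨κ, κ', h⟩ := exists_isQuasiPair hb hc hL a z
  have him := (h.exists_int hb hc hL).1
  rw [mem_blochSpectrum_iff h hb hc hL, Set.mem_uIcc] at hz
  have hhalf : nonReciprocityRate b c / (2 * L) = nonReciprocityRate b c / L / 2 := by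
    field_simp
  rw [hhalf]
  simp only [Set.mem_uIcc]
  rcases hz with hz | hz
  · rcases le_total κ.im (nonReciprocityRate b c / L / 2) with h' | h'
    · exact ⟨κ, κ', h, Or.inl ⟨by linarith, by linarith⟩⟩
    · exact ⟨κ', κ, h.symm, Or.inl ⟨by linarith, by linarith⟩⟩
  · rcases le_total κ.im (nonReciprocityRate b c / L / 2) with h' | h'
    · exact ⟨κ', κ, h.symm, Or.inr ⟨by linarith, by linarith⟩⟩
    · exact ⟨κ, κ', h, Or.inr ⟨by linarith, by linarith⟩⟩

end

end KToeplitz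
end

/-! ### The theorem -/

theorem mainTheorem10 (k : ℕ) [NeZero k] (a b c : Fin k → ℂ)
    (hb : ∀ j, b j ≠ 0) (hc : ∀ j, c j ≠ 0) (L : ℝ) (hL : 0 < L) :
    KToeplitz.blochSpectrum a b c L ⊆ spectrum ℂ (KToeplitz.toeplitz a b c) ∧
    (spectrum ℂ (KToeplitz.toeplitz a b c) \ KToeplitz.blochSpectrum a b c L).encard
      ≤ ((k - 1 : ℕ) : ℕ∞) ∧
    ∀ μ ∈ spectrum ℂ (KToeplitz.toeplitz a b c), μ ∈ KToeplitz.blochSpectrum a b c L →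
      ∃ κ κ' : ℂ,
        κ.re ∈ Set.Ico (-Real.pi / L) (Real.pi / L) ∧
        κ.im ∈ Set.uIcc 0 (KToeplitz.nonReciprocityRate b c / (2 * L)) ∧
        κ'.re ∈ Set.Ico (-Real.pi / L) (Real.pi / L) ∧
        κ'.im ∈ Set.uIcc (KToeplitz.nonReciprocityRate b c / (2 * L))
          (KToeplitz.nonReciprocityRate b c / L) ∧
        (∃ n : ℤ, κ'.re = -KToeplitz.phaseShift b c / L - κ.re + n * (2 * Real.pi / L)) ∧
        κ'.im = KToeplitz.nonReciprocityRate b c / L - κ.im ∧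
        {w ∈ KToeplitz.brillouinZone L (KToeplitz.nonReciprocityRate b c) |
          μ ∈ spectrum ℂ (KToeplitz.blochSymbol a b c L w)} = {κ, κ'} ∧
        spectrum ℂ (KToeplitz.blochSymbol a b c L κ)
          = spectrum ℂ (KToeplitz.blochSymbol a b c L κ') ∧
        (κ ≠ κ' →
          analyticOrderAt (KToeplitz.blochDet a b c L μ) κ = 1 ∧
          analyticOrderAt (KToeplitz.blochDet a b c L μ) κ' = 1) ∧
        (κ = κ' → analyticOrderAt (KToeplitz.blochDet a b c L μ) κ = 2) := by
  refine ⟨KToeplitz.blochSpectrum_subset hb hc hL,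
    (Set.encard_le_encard (KToeplitz.spectrum_diff_subset hb hc hL)).trans
      (KToeplitz.encard_psi_eq_zero_le hb), fun μ _ hμ => ?_⟩
  obtain ⟨κ, κ', h, hκ⟩ := KToeplitz.exists_isQuasiPair_half hb hc hL hμ
  obtain ⟨him, hre⟩ := h.exists_int hb hc hL
  have hhalf : KToeplitz.nonReciprocityRate b c / (2 * L)
      = KToeplitz.nonReciprocityRate b c / L / 2 := by
    field_simp
  have hκ' : κ'.im ∈ Set.uIcc (KToeplitz.nonReciprocityRate b c / (2 * L))
      (KToeplitz.nonReciprocityRate b c / L) := by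
    rw [hhalf, Set.mem_uIcc] at hκ ⊢
    rcases hκ with hκ | hκ
    · exact Or.inl ⟨by linarith, by linarith⟩
    · exact Or.inr ⟨by linarith, by linarith⟩
  refine ⟨κ, κ', h.fst_re, hκ, h.snd_re, hκ', hre, him, ?_, h.spectrum_eq hc,
    fun hne => ⟨h.analyticOrderAt_eq_one hb hc hL hne,
      h.symm.analyticOrderAt_eq_one hb hc hL hne.symm⟩, ?_⟩
  · ext w
    constructor
    · rintro ⟨hw, hμw⟩
      exact (h.mem_spectrum_iff hb hL hw.1).1 hμw
    · rintro (rfl | rfl)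
      · exact ⟨⟨h.fst_re, (KToeplitz.mem_blochSpectrum_iff h hb hc hL).1 hμ⟩,
          (h.mem_spectrum_iff hb hL h.fst_re).2 (Or.inl rfl)⟩
      · exact ⟨⟨h.snd_re, (KToeplitz.mem_blochSpectrum_iff h.symm hb hc hL).1 hμ⟩,
          (h.mem_spectrum_iff hb hL h.snd_re).2 (Or.inr rfl)⟩
  · rintro rfl
    exact h.analyticOrderAt_eq_two hb hc hL
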